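/- Let $n\ge 2$. Let $J_n$ be the Jordan block with $J_ne_i=e_{i-1}$ ($e_0=0$), and write $\lfloor y\rceil^a=|y|^a\,\mathrm{sign}(y)$ for $a>0$. Put $p_i=1-\frac{i-1}{n}$, $\beta_0=p_2$, $\beta_i=\frac{n-1+i}{n-i}$ for $1\le i\le n-1$, and $\alpha=\frac{2(n-1)}{2n-1}$. For positive $l_1,\dots,l_n$ define $v_0=0$ and, for $1\le i\le n$, $$\omega_i=\lfloor x_i\rceil^{\beta_{i-1}}-\lfloor v_{i-1}\rceil^{\beta_{i-1}},\qquad v_i=-l_i\lfloor\omega_i\rceil^{p_{i+1}/(p_i\beta_{i-1})}\ \ (i\le n-1),$$ $$V_n(x)=\sum_{i=1}^n\int_{v_{i-1}}^{x_i}\big(\lfloor s\rceil^{\beta_{i-1}}-\lfloor v_{i-1}\rceil^{\beta_{i-1}}\big)\,ds .$$ Call $(l_1,\dots,l_n,c_n)$, all positive, a Lyapunov tuple if $V_n$ is differentiable and its derivative along $\dot x=J_nx+e_nu$ satisfies, for all $x\in\mathbb{R}^n$ and $u\in\mathbb{R}$, $$\dot V_n\le -c_nV_n^\alpha(x)+\omega_n(x)\big(u+l_n\,\mathrm{sign}(\omega_n(x))\big).$$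 An S-function is a locally Lipschitz $\sigma:\mathbb{R}\to\mathbb{R}$ for which there are positive $a_1\le a_2$, $b_1$, $b_2$ with $\frac{a_1}{b_1}\le\frac{a_2}{b_2}$ and $a_1x\,s(x/b_1)\le x\sigma(x)\le a_2x\,s(x/b_2)$ for all $x$, where $s(x)=x/\max(1,|x|)$, and whose limits $\sigma_{+\infty}$ and $-\sigma_{+\infty}$ at $+\infty$ and $-\infty$ satisfy, with a constant $C_\sigma>0$, $|\sigma(|x|)-\sigma_{+\infty}|\le\frac{C_\sigma}{1+|x|}$ and $|\sigma(-|x|)+\sigma_{+\infty}|\le\frac{C_\sigma}{1+|x|}$ for all $x$. Put $\sigma_k(y)=\sigma(ky)$. For a tuple $(l_1,\dots,l_n,c_n)$ and an S-function $\sigma$ with constant $C_\sigma$, consider the assertion (B) for all $k$ large enough (how large does not depend on $d$ or on the trajectory), every $d\in L_\infty(\mathbb{R}_+)$ and every trajectory $x_d$ on $[0,\infty)$ (locally absolutely continuous solution for almost every time) of $\dot x=J_nx-l_ne_n\sigma_k(\omega_n(x)+d)$ satisfy $$\limsup_{s\to\infty}V_n^\alpha(x_d(s))\le\frac{2l_n}{c_n}\Big(\frac{1+C_\sigma}{k}+2\|d\|_\infty\Big).$$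 Then Lyapunov tuples exist, and for every Lyapunov tuple $(l_1,\dots,l_n,c_n)$: 1. (B) holds for every S-function $\sigma$ with $\sigma_{+\infty}\ge1$ and $|\sigma|\le3$ (in particular whenever $|\sigma|\le\sigma_{+\infty}=1$); 2. there is $c_n'\in(0,c_n]$, depending only on $n,l_1,\dots,l_n,c_n$, such that $(l_1,\dots,l_n,c_n')$ is a Lyapunov tuple and (B) holds with $c_n'$ in place of $c_n$ for every S-function $\sigma$ with $\sigma_{+\infty}\ge1$. -/

import Mathlib

open MeasureTheory Filter Topology

noncomputable section

namespace HongFeedback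

/-- The standard saturation `s(x) = x / max(1, |x|)`. -/
def sat (x : ℝ) : ℝ := x / max 1 |x|

/-- `σ` is an S-function with limit `L = σ_{+∞}` at `+∞` and with rate constant `C = C_σ`. The rate
holds on both half-lines: `|σ(x) - L| ≤ C/(1+|x|)` for `x ≥ 0` and `|σ(x) + L| ≤ C/(1+|x|)` for
`x ≤ 0`. -/
structure IsSFunction (σ : ℝ → ℝ) (L C : ℝ) : Prop where
  locallyLipschitz : LocallyLipschitz σ
  sector : ∃ a₁ a₂ b₁ b₂ : ℝ, 0 < a₁ ∧ 0 < b₁ ∧ 0 < b₂ ∧ a₁ ≤ a₂ ∧ a₁ / b₁ ≤ a₂ / b₂ ∧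
    ∀ x : ℝ, a₁ * x * sat (x / b₁) ≤ x * σ x ∧ x * σ x ≤ a₂ * x * sat (x / b₂)
  tendsto_atTop : Tendsto σ atTop (𝓝 L)
  tendsto_atBot : Tendsto σ atBot (𝓝 (-L))
  rate_pos : 0 < C
  rate_right : ∀ x : ℝ, |σ |x| - L| ≤ C / (1 + |x|)
  rate_left : ∀ x : ℝ, |σ (-|x|) + L| ≤ C / (1 + |x|)

/-- The signed power `⌊x⌉^a = |x|^a sign(x)`; it is used with `a > 0` only. -/
def spow (x a : ℝ) : ℝ := Real.sign x * |x| ^ a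

/-- The weights `p_i = 1 - (i-1)/n`. -/
def p (n i : ℕ) : ℝ := 1 - ((i : ℝ) - 1) / n

/-- The exponents `β_0 = p_2` and `β_i = (n-1+i)/(n-i)` for `1 ≤ i ≤ n-1`. -/
def β (n i : ℕ) : ℝ := if i = 0 then p n 2 else ((n : ℝ) - 1 + i) / ((n : ℝ) - i)

/-- The coordinate `x_i`, numbered from `1` to `n`. -/
def coord {n : ℕ} (x : Fin n → ℝ) (i : ℕ) : ℝ :=
  if h : 1 ≤ i ∧ i ≤ n then x ⟨i - 1, by omega⟩ else 0

/-- `v_0 = 0` and `v_i = -l_i ⌊ω_i⌉^{p_{i+1}/(p_i β_{i-1})}`,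
where `ω_i = ⌊x_i⌉^{β_{i-1}} - ⌊v_{i-1}⌉^{β_{i-1}}`. -/
def v (n : ℕ) (l : ℕ → ℝ) (x : Fin n → ℝ) : ℕ → ℝ
  | 0 => 0
  | i + 1 => - l (i + 1) *
      spow (spow (coord x (i + 1)) (β n i) - spow (v n l x i) (β n i))
        (p n (i + 2) / (p n (i + 1) * β n i))

/-- `ω_i = ⌊x_i⌉^{β_{i-1}} - ⌊v_{i-1}⌉^{β_{i-1}}` for `1 ≤ i ≤ n`. -/
def ω (n : ℕ) (l : ℕ → ℝ) (i : ℕ) (x : Fin n → ℝ) : ℝ :=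
  spow (coord x i) (β n (i - 1)) - spow (v n l x (i - 1)) (β n (i - 1))

/-- `W_i`, that is, the integral of `⌊s⌉^{β_{i-1}} - ⌊v_{i-1}⌉^{β_{i-1}}` over `s` from `v_{i-1}` to
`x_i`, in closed form. -/
def W (n : ℕ) (l : ℕ → ℝ) (i : ℕ) (x : Fin n → ℝ) : ℝ :=
  (|coord x i| ^ (β n (i - 1) + 1) - |v n l x (i - 1)| ^ (β n (i - 1) + 1)) / (β n (i - 1) + 1)
    - spow (v n l x (i - 1)) (β n (i - 1)) * (coord x i - v n l x (i - 1))

/-- `V_n = W_1 + ⋯ + W_n`. -/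
def V (n : ℕ) (l : ℕ → ℝ) (x : Fin n → ℝ) : ℝ := ∑ i ∈ Finset.Icc 1 n, W n l i x

/-- `α = 2(n-1)/(2n-1)`. -/
def α (n : ℕ) : ℝ := 2 * ((n : ℝ) - 1) / (2 * (n : ℝ) - 1)

/-- The Jordan block `J_n`, with `J_n e_i = e_{i-1}`. -/
def J (n : ℕ) : Matrix (Fin n) (Fin n) ℝ :=
  Matrix.of fun i j => if (j : ℕ) = (i : ℕ) + 1 then 1 else 0

/-- The vector `e_n`. -/
def eLast (n : ℕ) : Fin n → ℝ := fun i => if (i : ℕ) + 1 = n then 1 else 0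

/-- `l_1, …, l_n` and `c = c_n` are positive constants for which, along `x' = J_n x + e_n u`,
`V_n' ≤ -c_n V_n^α + ω_n(x) (u + l_n sign(ω_n(x)))`. The derivative of `V_n` along the control
system is the differential of `V_n` applied to `J_n x + u e_n`. -/
def IsLyapunovPair (n : ℕ) (l : ℕ → ℝ) (c : ℝ) : Prop :=
  (∀ i, 1 ≤ i → i ≤ n → 0 < l i) ∧ 0 < c ∧
  ∀ (x : Fin n → ℝ) (u : ℝ), ∃ V' : (Fin n → ℝ) →L[ℝ] ℝ, HasFDerivAt (V n l) V' x ∧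
    V' ((J n).mulVec x + u • eLast n) ≤
      -c * V n l x ^ α n + ω n l n x * (u + l n * Real.sign (ω n l n x))

/-- `x` is a trajectory on `[0,∞)` of `x' = J_n x - l_n e_n σ_k(ω_n(x) + d)`, with
`σ_k(y) = σ(k y)`: it is absolutely continuous on every `[0,T]` and solves the equation for almost
every positive time. -/
def IsTrajectory (n : ℕ) (l : ℕ → ℝ) (σ : ℝ → ℝ) (k : ℝ) (d : ℝ → ℝ) (x : ℝ → Fin n → ℝ) : Prop :=
  (∀ T : ℝ, 0 ≤ T → AbsolutelyContinuousOnInterval x 0 T) ∧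
  ∀ᵐ t ∂(volume.restrict (Set.Ioi (0 : ℝ))),
    HasDerivAt x ((J n).mulVec (x t) - (l n * σ (k * (ω n l n (x t) + d t))) • eLast n) t

/-- `d ∈ L_∞(ℝ₊)`. -/
def MemLinfty (d : ℝ → ℝ) : Prop := MemLp d ⊤ (volume.restrict (Set.Ici (0 : ℝ)))

/-- `‖d‖_∞`, the essential supremum of `|d|` on `ℝ₊`. -/
def normLinfty (d : ℝ → ℝ) : ℝ := (eLpNorm d ⊤ (volume.restrict (Set.Ici (0 : ℝ)))).toReal

/-- For all `k` large enough, uniformly in `d ∈ L_∞(ℝ₊)` and in the trajectory,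
`limsup_{t → ∞} V_n^α(x(t)) ≤ (2 l_n / c) ((1 + C) / k + 2 ‖d‖_∞)`. The upper limit is taken in the
extended reals. -/
def PracticalBound (n : ℕ) (l : ℕ → ℝ) (c : ℝ) (σ : ℝ → ℝ) (C : ℝ) : Prop :=
  ∃ k₀ : ℝ, 0 < k₀ ∧ ∀ k : ℝ, k₀ ≤ k → ∀ d : ℝ → ℝ, MemLinfty d →
    ∀ x : ℝ → Fin n → ℝ, IsTrajectory n l σ k d x →
      limsup (fun t : ℝ => ((V n l (x t) ^ α n : ℝ) : EReal)) atTop ≤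
        ((2 * l n / c * ((1 + C) / k + 2 * normLinfty d) : ℝ) : EReal)

end HongFeedback

end

noncomputable section

namespace HongFeedback

/-! Existence rests on homogeneity for the dilations x_i ↦ r^{p_i} x_i. The weights give every W_i
the degree (2n-1)/n. The drift J_n lowers degrees by 1/n, and so does raising V to the power α.
Inequalities between drift derivatives, V^α and powers of |ω| thus reduce to a compact sphere: if
the left side is negative where ω vanishes, a large multiple of the power of |ω| controls it
elsewhere (`IsHom.exists_le`). Backstepping then applies: on ω_{i+1} = 0 one has x_{i+1} = v_i, so
V_i already decreases, and the constant from compactness serves as the gain l_{i+1} (`exists_gain`,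
`exists_gains`). Although v_i need not be differentiable, ⌊v_i⌉^{β_i} is C¹, and W_{i+1} is C¹ when
written with the conjugate power of that quantity.

Along a trajectory, V' ≤ -c V^α + l_n (|ω| - ω σ_k(ω + d)). With D = ‖d‖_∞, if |ω| ≥ 2D then the
decay rate of σ bounds the bracket by 2C/k. If |ω| < 2D and |σ| ≤ 3, it is at most 4D, and a scalar
comparison principle gives the first claim.

For an S-function without that bound, the region of small ω is removed from the argument: W_n is
replaced by max(W_n, τ). Above τ the variable ω is large enough for the decay estimate. Below τ the
maximum is constant, and only V_{n-1} remains, whose derivative does not involve the input;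
homogeneity gives V_{n-1}' ≤ -c₁ V^α + K W_n^α (`IsLyapunovPair.exists_fderiv_Vpart_le`). The
identity (1 + 1/β_{n-1}) α = 1 makes τ^α linear in the threshold on |ω|, so the final constant does
not depend on the size of σ (`deriv_truncV_le`). -/

/-! ### Signed powers -/

theorem spow_zero (a : ℝ) : spow 0 a = 0 := by simp [spow]

theorem spow_of_pos {x : ℝ} (hx : 0 < x) (a : ℝ) : spow x a = x ^ a := by
  simp [spow, Real.sign_of_pos hx, abs_of_pos hx]

theorem spow_of_nonneg {x a : ℝ} (hx : 0 ≤ x) (ha : a ≠ 0) : spow x a = x ^ a := by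
  rcases hx.eq_or_lt with rfl | h
  · simp [spow, Real.zero_rpow ha]
  · exact spow_of_pos h a

theorem spow_neg (x a : ℝ) : spow (-x) a = -spow x a := by
  simp [spow, Real.sign_neg]

theorem abs_spow (x : ℝ) {a : ℝ} (ha : a ≠ 0) : |spow x a| = |x| ^ a := by
  rcases lt_trichotomy x 0 with h | rfl | h
  · simp [spow, Real.sign_of_neg h, abs_of_nonneg (Real.rpow_nonneg (abs_nonneg x) a)]
  · simp [spow, Real.zero_rpow ha]
  · simp [spow, Real.sign_of_pos h, abs_of_nonneg (Real.rpow_nonneg (abs_nonneg x) a)]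

theorem spow_mul (x y a : ℝ) : spow (x * y) a = spow x a * spow y a := by
  have key : ∀ x y : ℝ, 0 < x → spow (x * y) a = spow x a * spow y a := by
    intro x y hx
    have hs : Real.sign (x * y) = Real.sign y := by
      rcases lt_trichotomy y 0 with h | rfl | h
      · rw [Real.sign_of_neg h, Real.sign_of_neg (mul_neg_of_pos_of_neg hx h)]
      · simp
      · rw [Real.sign_of_pos h, Real.sign_of_pos (mul_pos hx h)]
    rw [spow_of_pos hx, spow, hs, abs_mul, Real.mul_rpow (abs_nonneg _) (abs_nonneg _),
      abs_of_pos hx, spow]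
    ring
  rcases lt_trichotomy x 0 with h | rfl | h
  · have := key (-x) y (by linarith)
    rw [neg_mul, spow_neg, spow_neg] at this
    linarith
  · simp [spow_zero]
  · exact key x y h

theorem spow_spow (x a b : ℝ) : spow (spow x a) b = spow x (a * b) := by
  have key : ∀ x : ℝ, 0 < x → spow (spow x a) b = spow x (a * b) := fun x hx => by
    rw [spow_of_pos hx, spow_of_pos (Real.rpow_pos_of_pos hx a), spow_of_pos hx,
      Real.rpow_mul hx.le]
  rcases lt_trichotomy x 0 with h | rfl | h
  · have := key (-x) (by linarith)
    rw [spow_neg, spow_neg, spow_neg] at this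
    linarith
  · simp [spow_zero]
  · exact key x h

theorem spow_one (x : ℝ) : spow x 1 = x := by
  rcases lt_trichotomy x 0 with h | rfl | h
  · simp [spow, Real.sign_of_neg h, abs_of_neg h]
  · simp [spow]
  · simp [spow, Real.sign_of_pos h, abs_of_pos h]

theorem mul_spow (x : ℝ) {a : ℝ} (ha : 0 ≤ a) : x * spow x a = |x| ^ (a + 1) := by
  rcases eq_or_ne x 0 with rfl | hx
  · simp [Real.zero_rpow (by positivity : a + 1 ≠ 0)]
  · rw [Real.rpow_add (abs_pos.2 hx), Real.rpow_one, spow]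
    rcases hx.lt_or_gt with h | h
    · rw [Real.sign_of_neg h, abs_of_neg h]; ring
    · rw [Real.sign_of_pos h, abs_of_pos h]; ring

theorem spow_strictMono {a : ℝ} (ha : 0 < a) : StrictMono fun x => spow x a := by
  intro x y hxy
  simp only
  rcases le_or_gt 0 x with hx | hx
  · rw [spow_of_nonneg hx ha.ne', spow_of_pos (hx.trans_lt hxy)]
    exact Real.rpow_lt_rpow hx hxy ha
  · have h1 : spow x a < 0 := by
      have := spow_neg x a
      rw [spow_of_pos (by linarith : 0 < -x)] at this
      linarith [Real.rpow_pos_of_pos (by linarith : 0 < -x) a]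
    rcases le_or_gt 0 y with hy | hy
    · rw [spow_of_nonneg hy ha.ne']
      linarith [Real.rpow_nonneg hy a]
    · have h2 := spow_neg x a
      have h3 := spow_neg y a
      rw [spow_of_pos (by linarith)] at h2 h3
      linarith [Real.rpow_lt_rpow (by linarith : 0 ≤ -y) (by linarith : -y < -x) ha]

theorem spow_rpow_inv (x : ℝ) {a : ℝ} (ha : a ≠ 0) : spow (spow x a) a⁻¹ = x := by
  rw [spow_spow, mul_inv_cancel₀ ha, spow_one]

theorem spow_inv_rpow (x : ℝ) {a : ℝ} (ha : a ≠ 0) : spow (spow x a⁻¹) a = x := by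
  rw [spow_spow, inv_mul_cancel₀ ha, spow_one]

theorem continuous_spow {a : ℝ} (ha : 0 < a) : Continuous fun x => spow x a :=
  (spow_strictMono ha).monotone.continuous_of_surjective
    fun y => ⟨spow y a⁻¹, spow_inv_rpow y ha.ne'⟩

theorem hasDerivAt_spow {a : ℝ} (ha : 1 < a) (x : ℝ) :
    HasDerivAt (fun x => spow x a) (a * |x| ^ (a - 1)) x := by
  have hpos : ∀ y : ℝ, 0 < y → HasDerivAt (fun x => spow x a) (a * |y| ^ (a - 1)) y := by
    intro y hy
    have h1 := Real.hasDerivAt_rpow_const (x := y) (p := a) (Or.inl hy.ne')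
    rw [abs_of_pos hy]
    refine h1.congr_of_eventuallyEq ?_
    filter_upwards [eventually_gt_nhds hy] with z hz using spow_of_pos hz a
  -- At 0 the derivative is obtained as the limit of the derivatives nearby, which exists because a
  -- - 1 > 0.
  refine hasDerivAt_of_hasDerivAt_of_ne' (x := 0) (g := fun x => a * |x| ^ (a - 1)) ?_
    (continuous_spow (by linarith)).continuousAt ?_ x
  · intro y hy
    rcases hy.lt_or_gt with h | h
    · have h1 := ((hpos (-y) (by linarith)).comp y (hasDerivAt_neg y)).neg
      rw [abs_neg] at h1
      convert h1 using 1
      · ext z; simp [spow_neg]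
      · simp
    · exact hpos y h
  · exact (continuous_const.mul (continuous_abs.rpow_const fun _ => Or.inr (by linarith))).continuousAt

theorem contDiff_spow {a : ℝ} (ha : 1 ≤ a) : ContDiff ℝ 1 fun x => spow x a := by
  rcases ha.eq_or_lt with rfl | h
  · simpa only [spow_one] using contDiff_fun_id
  · refine contDiff_one_iff_deriv.2 ⟨fun x => (hasDerivAt_spow h x).differentiableAt, ?_⟩
    have : deriv (fun x => spow x a) = fun x => a * |x| ^ (a - 1) :=
      funext fun x => (hasDerivAt_spow h x).deriv
    rw [this]
    exact continuous_const.mul (continuous_abs.rpow_const fun _ => Or.inr (by linarith))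

/-- The primitive `|x|^(a+1) / (a+1)` of the signed power. -/
theorem hasDerivAt_abs_rpow_div {a : ℝ} (ha : 0 < a) (x : ℝ) :
    HasDerivAt (fun x => |x| ^ (a + 1) / (a + 1)) (spow x a) x := by
  have h := (hasDerivAt_abs_rpow x (by linarith : 1 < a + 1)).div_const (a + 1)
  refine h.congr_deriv ?_
  have ha' : a + 1 ≠ 0 := by positivity
  rcases lt_trichotomy x 0 with hx | rfl | hx
  · rw [spow, Real.sign_of_neg hx, show a + 1 - 2 = a - 1 by ring,
      Real.rpow_sub_one (abs_pos.2 hx.ne).ne', abs_of_neg hx]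
    field_simp [hx.ne]
  · simp [spow_zero]
  · rw [spow, Real.sign_of_pos hx, show a + 1 - 2 = a - 1 by ring,
      Real.rpow_sub_one (abs_pos.2 hx.ne').ne', abs_of_pos hx]
    field_simp

theorem contDiff_abs_rpow_div {a : ℝ} (ha : 0 < a) :
    ContDiff ℝ 1 fun x : ℝ => |x| ^ (a + 1) / (a + 1) := by
  refine contDiff_one_iff_deriv.2 ⟨fun x => (hasDerivAt_abs_rpow_div ha x).differentiableAt, ?_⟩
  rw [show deriv (fun x : ℝ => |x| ^ (a + 1) / (a + 1)) = fun x => spow x a from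
    funext fun x => (hasDerivAt_abs_rpow_div ha x).deriv]
  exact continuous_spow ha

/-! ### Bregman divergences of powers -/

/-- The Bregman divergence of `|s|^(b+1) / (b+1)` from `y` to `x`. -/
def bregman (b x y : ℝ) : ℝ :=
  (|x| ^ (b + 1) - |y| ^ (b + 1)) / (b + 1) - spow y b * (x - y)

theorem hasDerivAt_bregman {b : ℝ} (hb : 0 < b) (x y : ℝ) :
    HasDerivAt (fun x => bregman b x y) (spow x b - spow y b) x := by
  have h := ((hasDerivAt_abs_rpow_div hb x).sub_const (|y| ^ (b + 1) / (b + 1))).sub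
    (((hasDerivAt_id x).sub_const y).const_mul (spow y b))
  refine (h.congr_deriv (by simp)).congr_of_eventuallyEq (.of_forall fun z => ?_)
  simp [bregman, sub_div]

/-- The divergence in terms of the conjugate function. -/
theorem bregman_eq {b : ℝ} (hb : 0 < b) (x y : ℝ) :
    bregman b x y = |x| ^ (b + 1) / (b + 1) + |spow y b| ^ (b⁻¹ + 1) / (b⁻¹ + 1)
      - spow y b * x := by
  have h1 : |spow y b| ^ (b⁻¹ + 1) = |y| ^ (b + 1) := by
    rw [abs_spow y hb.ne', ← Real.rpow_mul (abs_nonneg y)]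
    congr 1
    field_simp
    ring
  rw [h1, bregman]
  have h2 := mul_spow y hb.le
  have hb' : b + 1 ≠ 0 := by positivity
  have h3 : spow y b * (x - y) = spow y b * x - |y| ^ (b + 1) := by rw [← h2]; ring
  rw [h3]
  field_simp
  ring

/-- Young's inequality for the conjugate exponents b + 1 and 1/b + 1, applied to x and ⌊y⌉^b. -/
theorem bregman_nonneg {b : ℝ} (hb : 0 < b) (x y : ℝ) : 0 ≤ bregman b x y := by
  have hc : Real.HolderConjugate (b + 1) (b⁻¹ + 1) := by
    rw [Real.holderConjugate_iff]
    refine ⟨by linarith, ?_⟩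
    field_simp
    ring
  have := Real.young_inequality x (spow y b) hc
  rw [bregman_eq hb]
  linarith

theorem bregman_self (b x : ℝ) : bregman b x x = 0 := by simp [bregman]

/-- A zero is a minimum in the first argument, so the derivative ⌊x⌉^b - ⌊y⌉^b vanishes there;
signed powers are injective. -/
theorem eq_of_bregman_eq_zero {b x y : ℝ} (hb : 0 < b) (h : bregman b x y = 0) : x = y := by
  have hmin : IsLocalMin (fun x => bregman b x y) x :=
    Filter.Eventually.of_forall fun z => by simpa only [h] using bregman_nonneg hb z y
  have h0 := hmin.hasDerivAt_eq_zero (hasDerivAt_bregman hb x y)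
  exact (spow_strictMono hb).injective (sub_eq_zero.1 h0)

/-- The product on the right is the sum of the two divergences with x and y exchanged, and both are
nonnegative. -/
theorem bregman_le {b : ℝ} (hb : 0 < b) (x y : ℝ) :
    bregman b x y ≤ (spow x b - spow y b) * (x - y) := by
  have h := bregman_nonneg hb y x
  have hb' : b + 1 ≠ 0 := by positivity
  have : bregman b x y + bregman b y x = (spow x b - spow y b) * (x - y) := by
    simp only [bregman]
    field_simp
    ring
  linarith

/-- Signed powers with exponent at most `1` are Hölder continuous. -/
theorem abs_spow_sub_spow_le {r : ℝ} (hr : 0 < r) (hr1 : r ≤ 1) (x y : ℝ) :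
    |spow x r - spow y r| ≤ 2 * |x - y| ^ r := by
  have key : ∀ x y : ℝ, 0 ≤ x → y ≤ x → |spow x r - spow y r| ≤ 2 * |x - y| ^ r := by
    intro x y hx hyx
    have hm : spow y r ≤ spow x r := (spow_strictMono hr).monotone hyx
    rw [abs_of_nonneg (sub_nonneg.2 hm), abs_of_nonneg (sub_nonneg.2 hyx)]
    have h0 : 0 ≤ (x - y) ^ r := Real.rpow_nonneg (sub_nonneg.2 hyx) r
    rcases le_or_gt 0 y with hy | hy
    · have := Real.rpow_add_le_add_rpow (sub_nonneg.2 hyx) hy hr.le hr1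
      rw [sub_add_cancel] at this
      rw [spow_of_nonneg hx hr.ne', spow_of_nonneg hy hr.ne']
      linarith
    · have h2 := spow_neg y r
      rw [spow_of_pos (by linarith)] at h2
      rw [spow_of_nonneg hx hr.ne']
      have h3 := Real.rpow_le_rpow hx (by linarith : x ≤ x - y) hr.le
      have h4 := Real.rpow_le_rpow (by linarith) (by linarith : -y ≤ x - y) hr.le
      linarith
  have key2 : ∀ x y : ℝ, y ≤ x → |spow x r - spow y r| ≤ 2 * |x - y| ^ r := by
    intro x y hyx
    rcases le_or_gt 0 x with hx | hx
    · exact key x y hx hyx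
    · have := key (-y) (-x) (by linarith) (by linarith)
      rw [spow_neg, spow_neg] at this
      rwa [neg_sub_neg, neg_sub_neg] at this
  rcases le_total y x with h | h
  · exact key2 x y h
  · rw [abs_sub_comm, abs_sub_comm x]
    exact key2 y x h

/-! ### Exponents -/

theorem p_succ_eq (n i : ℕ) (hn : 0 < n) : p n (i + 1) = ((n : ℝ) - i) / n := by
  have : (n : ℝ) ≠ 0 := by positivity
  simp only [p]
  push_cast
  field_simp
  ring

theorem p_succ_pos {n i : ℕ} (hi : i < n) : 0 < p n (i + 1) := by
  rw [p_succ_eq n i (by omega)]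
  have : (i : ℝ) < n := by exact_mod_cast hi
  have : (0 : ℝ) < n := by exact_mod_cast (by omega : 0 < n)
  exact div_pos (by linarith) this

theorem p_succ_nonneg {n i : ℕ} (hn : 0 < n) (hi : i ≤ n) : 0 ≤ p n (i + 1) := by
  rw [p_succ_eq n i hn]
  have : (i : ℝ) ≤ n := by exact_mod_cast hi
  exact div_nonneg (by linarith) (by positivity)

theorem p_add_two (n i : ℕ) : p n (i + 2) = p n (i + 1) - 1 / n := by
  simp only [p]
  push_cast
  ring

theorem β_eq {n : ℕ} (hn : 0 < n) (i : ℕ) : β n i = ((n : ℝ) - 1 + i) / ((n : ℝ) - i) := by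
  rcases eq_or_ne i 0 with rfl | h
  · have : (n : ℝ) ≠ 0 := by positivity
    simp only [β, p, if_true]
    push_cast
    field_simp
    ring
  · simp [β, h]

theorem β_pos {n i : ℕ} (hn : 2 ≤ n) (hi : i < n) : 0 < β n i := by
  rw [β_eq (by omega)]
  have h1 : (i : ℝ) < n := by exact_mod_cast hi
  have h2 : (2 : ℝ) ≤ n := by exact_mod_cast hn
  have h3 : (0 : ℝ) ≤ i := by positivity
  exact div_pos (by linarith) (by linarith)

theorem one_le_β {n i : ℕ} (hi0 : 1 ≤ i) (hi : i < n) : 1 ≤ β n i := by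
  rw [β_eq (by omega)]
  have h1 : (i : ℝ) < n := by exact_mod_cast hi
  have h2 : (1 : ℝ) ≤ i := by exact_mod_cast hi0
  rw [one_le_div (by linarith)]
  linarith

theorem p_mul_β {n i : ℕ} (hi : i < n) : p n (i + 1) * β n i = ((n : ℝ) - 1 + i) / n := by
  rw [p_succ_eq n i (by omega), β_eq (by omega)]
  have h1 : (n : ℝ) - i ≠ 0 := sub_ne_zero.2 (by exact_mod_cast hi.ne')
  have h2 : (n : ℝ) ≠ 0 := by exact_mod_cast (by omega : n ≠ 0)
  field_simp

/-- The right side does not depend on i: this common value is the degree of every W_i. -/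
theorem p_mul_β_add_one {n i : ℕ} (hi : i < n) :
    p n (i + 1) * (β n i + 1) = (2 * (n : ℝ) - 1) / n := by
  rw [mul_add, p_mul_β hi, p_succ_eq n i (by omega)]
  ring

/-- The exponent of `ω_{i+1}` in `v_{i+1}`. -/
def feedbackExp (n i : ℕ) : ℝ := p n (i + 2) / (p n (i + 1) * β n i)

theorem feedbackExp_nonneg {n i : ℕ} (hn : 2 ≤ n) (hi : i < n) : 0 ≤ feedbackExp n i :=
  div_nonneg (p_succ_nonneg (i := i + 1) (by omega) hi)
    (mul_pos (p_succ_pos hi) (β_pos hn hi)).le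

theorem mul_feedbackExp {n i : ℕ} (hn : 2 ≤ n) (hi : i < n) :
    p n (i + 1) * β n i * feedbackExp n i = p n (i + 2) :=
  mul_div_cancel₀ _ (mul_pos (p_succ_pos hi) (β_pos hn hi)).ne'

theorem feedbackExp_mul_β {n i : ℕ} (hn : 2 ≤ n) (hi : i + 1 < n) :
    feedbackExp n i * β n (i + 1) = ((n : ℝ) + i) / (n - 1 + i) := by
  have h := p_mul_β hi
  rw [feedbackExp, p_mul_β (by omega : i < n), div_mul_eq_mul_div, h]
  have h2 : (2 : ℝ) ≤ n := by exact_mod_cast hn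
  have h3 : (0 : ℝ) ≤ i := by positivity
  have h4 : (n : ℝ) - 1 + i ≠ 0 := by linarith
  push_cast
  field_simp
  ring

/-- This is the exponent of ω_{i+1} in ⌊v_{i+1}⌉^{β_{i+1}}; being at least 1, it makes that power
differentiable even where ω_{i+1} vanishes. -/
theorem one_le_feedbackExp_mul_β {n i : ℕ} (hn : 2 ≤ n) (hi : i + 1 < n) :
    1 ≤ feedbackExp n i * β n (i + 1) := by
  rw [feedbackExp_mul_β hn hi]
  have h2 : (2 : ℝ) ≤ n := by exact_mod_cast hn
  have h3 : (0 : ℝ) ≤ i := by positivity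
  rw [one_le_div (by linarith)]
  linarith

/-- Since β_0 < 1, the inner power of x_1 is not C¹. The exponents cancel exactly, so ⌊v_1⌉^{β_1} is
linear in x_1. -/
theorem β_zero_mul_feedbackExp {n : ℕ} (hn : 2 ≤ n) :
    β n 0 * (feedbackExp n 0 * β n 1) = 1 := by
  rw [feedbackExp_mul_β hn (by omega : 0 + 1 < n), β_eq (by omega)]
  have h2 : (2 : ℝ) ≤ n := by exact_mod_cast hn
  have h4 : (n : ℝ) - 1 ≠ 0 := by linarith
  push_cast
  have h5 : (n : ℝ) ≠ 0 := by linarith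
  simp only [add_zero, sub_zero]
  field_simp

theorem α_pos {n : ℕ} (hn : 2 ≤ n) : 0 < α n := by
  have h2 : (2 : ℝ) ≤ n := by exact_mod_cast hn
  exact div_pos (by linarith) (by linarith)

theorem α_le_one {n : ℕ} (hn : 2 ≤ n) : α n ≤ 1 := by
  have h2 : (2 : ℝ) ≤ n := by exact_mod_cast hn
  rw [α, div_le_one (by linarith)]
  linarith

/-- The degree of V^α is the degree of V lowered by 1/n, hence that of the drift derivative of V. -/
theorem mul_α {n : ℕ} (hn : 2 ≤ n) :
    (2 * (n : ℝ) - 1) / n * α n = (2 * (n : ℝ) - 2) / n := by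
  have h2 : (2 : ℝ) ≤ n := by exact_mod_cast hn
  have h3 : 2 * (n : ℝ) - 1 ≠ 0 := by linarith
  rw [α]
  field_simp

/-! ### The functions in the design -/

/-- `coord` as a continuous linear functional. -/
def coordL (n i : ℕ) : (Fin n → ℝ) →L[ℝ] ℝ :=
  if h : 1 ≤ i ∧ i ≤ n then ContinuousLinearMap.proj ⟨i - 1, by omega⟩ else 0

theorem coordL_apply {n : ℕ} (i : ℕ) (x : Fin n → ℝ) : coordL n i x = coord x i := by
  by_cases h : 1 ≤ i ∧ i ≤ n <;> simp [coordL, coord, h]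

theorem contDiff_coord (n i : ℕ) : ContDiff ℝ 1 fun x : Fin n → ℝ => coord x i := by
  have : (fun x : Fin n → ℝ => coord x i) = coordL n i := funext fun x => (coordL_apply i x).symm
  rw [this]
  exact (coordL n i).contDiff

theorem fderiv_coord {n : ℕ} (i : ℕ) (x w : Fin n → ℝ) :
    fderiv ℝ (fun x : Fin n → ℝ => coord x i) x w = coord w i := by
  have : (fun x : Fin n → ℝ => coord x i) = coordL n i := funext fun x => (coordL_apply i x).symm
  rw [this, ContinuousLinearMap.fderiv, coordL_apply]

theorem ext_coord {n : ℕ} {x y : Fin n → ℝ}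
    (h : ∀ i, i < n → coord x (i + 1) = coord y (i + 1)) : x = y := by
  ext k
  have := h k k.2
  simpa [coord, Nat.succ_le_of_lt k.2] using this

/-- The signed power `⌊v_i⌉^{β_i}`. -/
def vpow (n : ℕ) (l : ℕ → ℝ) (i : ℕ) (x : Fin n → ℝ) : ℝ := spow (v n l x i) (β n i)

/-- The partial sum `V_i = W_1 + ⋯ + W_i`. -/
def Vpart (n : ℕ) (l : ℕ → ℝ) (i : ℕ) (x : Fin n → ℝ) : ℝ := ∑ j ∈ Finset.Icc 1 i, W n l j x

theorem Vpart_self (n : ℕ) (l : ℕ → ℝ) : Vpart n l n = V n l := rfl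

theorem Vpart_zero (n : ℕ) (l : ℕ → ℝ) (x : Fin n → ℝ) : Vpart n l 0 x = 0 := by simp [Vpart]

theorem Vpart_succ (n : ℕ) (l : ℕ → ℝ) (i : ℕ) (x : Fin n → ℝ) :
    Vpart n l (i + 1) x = Vpart n l i x + W n l (i + 1) x :=
  Finset.sum_Icc_succ_top (by omega) _

section design

variable {n : ℕ} {l : ℕ → ℝ}

theorem v_zero (x : Fin n → ℝ) : v n l x 0 = 0 := by simp [v]

theorem v_succ (i : ℕ) (x : Fin n → ℝ) :
    v n l x (i + 1) = -l (i + 1) * spow (ω n l (i + 1) x) (feedbackExp n i) := by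
  simp [v, ω, feedbackExp]

theorem vpow_zero (x : Fin n → ℝ) : vpow n l 0 x = 0 := by simp [vpow, v_zero, spow_zero]

theorem vpow_succ (i : ℕ) (x : Fin n → ℝ) :
    vpow n l (i + 1) x = spow (-l (i + 1)) (β n (i + 1)) *
      spow (ω n l (i + 1) x) (feedbackExp n i * β n (i + 1)) := by
  rw [vpow, v_succ, spow_mul, spow_spow]

theorem ω_zero (x : Fin n → ℝ) : ω n l 0 x = 0 := by
  simp [ω, coord, v_zero]

theorem ω_succ (i : ℕ) (x : Fin n → ℝ) :
    ω n l (i + 1) x = spow (coord x (i + 1)) (β n i) - vpow n l i x := rfl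

theorem W_succ (i : ℕ) (x : Fin n → ℝ) :
    W n l (i + 1) x = bregman (β n i) (coord x (i + 1)) (v n l x i) := rfl

theorem spow_vpow {i : ℕ} (hn : 2 ≤ n) (hi : i < n) (x : Fin n → ℝ) :
    spow (vpow n l i x) (β n i)⁻¹ = v n l x i := spow_rpow_inv _ (β_pos hn hi).ne'

theorem contDiff_vpow (hn : 2 ≤ n) : ∀ i, i < n → ContDiff ℝ 1 (vpow n l i) := by
  intro i
  induction i with
  | zero =>
    intro _
    have : vpow n l 0 = fun _ => 0 := funext vpow_zero
    rw [this]
    exact contDiff_const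
  | succ i ih =>
    intro hi
    rcases Nat.eq_zero_or_pos i with rfl | h0
    · have : vpow n l (0 + 1) = fun x => spow (-l 1) (β n 1) * coord x 1 := by
        ext x
        rw [vpow_succ, ω_succ, vpow_zero, sub_zero, spow_spow, zero_add,
          β_zero_mul_feedbackExp hn, spow_one]
      rw [this]
      exact contDiff_const.mul (contDiff_coord n 1)
    · have : vpow n l (i + 1) = fun x => spow (-l (i + 1)) (β n (i + 1)) *
          spow (spow (coord x (i + 1)) (β n i) - vpow n l i x)
            (feedbackExp n i * β n (i + 1)) :=
        funext fun x => by rw [vpow_succ, ω_succ]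
      rw [this]
      exact contDiff_const.mul ((contDiff_spow (one_le_feedbackExp_mul_β hn hi)).comp
        (((contDiff_spow (one_le_β h0 (by omega))).comp (contDiff_coord n (i + 1))).sub
          (ih (by omega))))

theorem continuous_ω {i : ℕ} (hn : 2 ≤ n) (hi : i < n) : Continuous (ω n l (i + 1)) :=
  ((continuous_spow (β_pos hn hi)).comp (contDiff_coord n (i + 1)).continuous).sub
    (contDiff_vpow hn i hi).continuous

theorem continuous_v {i : ℕ} (hn : 2 ≤ n) (hi : i < n) : Continuous fun x => v n l x i := by
  have : (fun x => v n l x i) = fun x => spow (vpow n l i x) (β n i)⁻¹ :=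
    funext fun x => (spow_vpow hn hi x).symm
  rw [this]
  exact (continuous_spow (inv_pos.2 (β_pos hn hi))).comp (contDiff_vpow hn i hi).continuous

/-- In this form only the C¹ functions x_{i+1} and ⌊v_i⌉^{β_i} enter, through powers with exponent
greater than 1. -/
theorem W_succ_eq {i : ℕ} (hn : 2 ≤ n) (hi : i < n) :
    W n l (i + 1) = fun x => |coord x (i + 1)| ^ (β n i + 1) / (β n i + 1)
      + |vpow n l i x| ^ ((β n i)⁻¹ + 1) / ((β n i)⁻¹ + 1) - vpow n l i x * coord x (i + 1) :=
  funext fun x => by rw [W_succ, bregman_eq (β_pos hn hi), vpow]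

theorem contDiff_W {i : ℕ} (hn : 2 ≤ n) (hi : i < n) : ContDiff ℝ 1 (W n l (i + 1)) := by
  rw [W_succ_eq hn hi]
  have hz := contDiff_vpow (l := l) hn i hi
  have hx := contDiff_coord n (i + 1)
  exact (((contDiff_abs_rpow_div (β_pos hn hi)).comp hx).add
    ((contDiff_abs_rpow_div (inv_pos.2 (β_pos hn hi))).comp hz)).sub (hz.mul hx)

theorem fderiv_W {i : ℕ} (hn : 2 ≤ n) (hi : i < n) (x w : Fin n → ℝ) :
    fderiv ℝ (W n l (i + 1)) x w = ω n l (i + 1) x * coord w (i + 1)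
      - (coord x (i + 1) - v n l x i) * fderiv ℝ (vpow n l i) x w := by
  have hz := ((contDiff_vpow (l := l) hn i hi).differentiable one_ne_zero x).hasFDerivAt
  have hx := ((contDiff_coord n (i + 1)).differentiable one_ne_zero x).hasFDerivAt
  have h1 := (hasDerivAt_abs_rpow_div (β_pos hn hi) (coord x (i + 1))).comp_hasFDerivAt x hx
  have h2 := (hasDerivAt_abs_rpow_div (inv_pos.2 (β_pos hn hi))
    (vpow n l i x)).comp_hasFDerivAt x hz
  have h3 := ((h1.add h2).sub (hz.mul hx)).congr_of_eventuallyEq (f₁ := W n l (i + 1))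
    (.of_forall fun y => by rw [W_succ_eq hn hi]; rfl)
  rw [h3.fderiv, ω_succ]
  simp only [sub_apply, add_apply,
    smul_apply, smul_eq_mul, fderiv_coord, spow_vpow hn hi]
  ring

theorem contDiff_Vpart {i : ℕ} (hn : 2 ≤ n) (hi : i ≤ n) : ContDiff ℝ 1 (Vpart n l i) := by
  change ContDiff ℝ 1 fun x => ∑ j ∈ Finset.Icc 1 i, W n l j x
  apply ContDiff.sum
  intro j hj
  rw [Finset.mem_Icc] at hj
  obtain ⟨k, rfl⟩ : ∃ k, j = k + 1 := ⟨j - 1, by omega⟩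
  exact contDiff_W hn (by omega)

theorem fderiv_Vpart_succ {i : ℕ} (hn : 2 ≤ n) (hi : i < n) (x w : Fin n → ℝ) :
    fderiv ℝ (Vpart n l (i + 1)) x w =
      fderiv ℝ (Vpart n l i) x w + fderiv ℝ (W n l (i + 1)) x w := by
  have : Vpart n l (i + 1) = fun x => Vpart n l i x + W n l (i + 1) x :=
    funext fun x => Vpart_succ n l i x
  rw [this, fderiv_fun_add ((contDiff_Vpart hn hi.le).differentiable one_ne_zero x)
    ((contDiff_W hn hi).differentiable one_ne_zero x)]
  rfl

/-! ### Positivity -/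

theorem W_nonneg {i : ℕ} (hn : 2 ≤ n) (hi : i < n) (x : Fin n → ℝ) : 0 ≤ W n l (i + 1) x :=
  bregman_nonneg (β_pos hn hi) _ _

theorem Vpart_nonneg {i : ℕ} (hn : 2 ≤ n) (hi : i ≤ n) (x : Fin n → ℝ) : 0 ≤ Vpart n l i x := by
  refine Finset.sum_nonneg fun j hj => ?_
  rw [Finset.mem_Icc] at hj
  obtain ⟨k, rfl⟩ : ∃ k, j = k + 1 := ⟨j - 1, by omega⟩
  exact W_nonneg hn (by omega) x

theorem coord_eq_v_of_W_eq_zero {i : ℕ} (hn : 2 ≤ n) (hi : i < n) {x : Fin n → ℝ}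
    (h : W n l (i + 1) x = 0) : coord x (i + 1) = v n l x i :=
  eq_of_bregman_eq_zero (β_pos hn hi) h

theorem ω_eq_zero_iff {i : ℕ} (hn : 2 ≤ n) (hi : i < n) {x : Fin n → ℝ} :
    ω n l (i + 1) x = 0 ↔ coord x (i + 1) = v n l x i := by
  rw [ω_succ, sub_eq_zero, vpow]
  exact (spow_strictMono (β_pos hn hi)).injective.eq_iff

/-- Each nonnegative summand vanishes, so successively x_{j+1} = v_j = 0; then ω_{j+1} = 0, which
gives v_{j+1} = 0 and lets the induction continue. -/
theorem eq_zero_of_Vpart_eq_zero (hn : 2 ≤ n) {x : Fin n → ℝ} :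
    ∀ i, i ≤ n → Vpart n l i x = 0 → (∀ j, j < i → coord x (j + 1) = 0) ∧ v n l x i = 0 := by
  intro i
  induction i with
  | zero => exact fun _ _ => ⟨by simp, v_zero x⟩
  | succ i ih =>
    intro hi h
    rw [Vpart_succ] at h
    have h1 := Vpart_nonneg (l := l) hn (by omega : i ≤ n) x
    have h2 := W_nonneg (l := l) hn hi x
    obtain ⟨h3, h4⟩ := ih (by omega) (by linarith)
    have h5 := coord_eq_v_of_W_eq_zero hn hi (by linarith : W n l (i + 1) x = 0)
    refine ⟨fun j hj => ?_, ?_⟩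
    · rcases Nat.lt_succ_iff_lt_or_eq.1 hj with h | rfl
      · exact h3 j h
      · rw [h5, h4]
    · rw [v_succ, (ω_eq_zero_iff hn hi).2 h5, spow_zero, mul_zero]

/-- `W_{i+1}` grows at most like `|ω_{i+1}|` to the power `1 + 1/β`. -/
theorem W_le {i : ℕ} (hn : 2 ≤ n) (hi0 : 1 ≤ i) (hi : i < n) (x : Fin n → ℝ) :
    W n l (i + 1) x ≤ 2 * |ω n l (i + 1) x| ^ (1 + (β n i)⁻¹) := by
  have hb := β_pos hn hi
  have h1 := abs_spow_sub_spow_le (inv_pos.2 hb) (inv_le_one_of_one_le₀ (one_le_β hi0 hi))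
    (spow (coord x (i + 1)) (β n i)) (vpow n l i x)
  rw [spow_rpow_inv _ hb.ne', spow_vpow hn hi, ← ω_succ] at h1
  have h2 := bregman_le hb (coord x (i + 1)) (v n l x i)
  have h3 : 0 < 1 + (β n i)⁻¹ := by positivity
  calc W n l (i + 1) x ≤ ω n l (i + 1) x * (coord x (i + 1) - v n l x i) := h2
    _ ≤ |ω n l (i + 1) x| * |coord x (i + 1) - v n l x i| := by
      rw [← abs_mul]; exact le_abs_self _
    _ ≤ |ω n l (i + 1) x| * (2 * |ω n l (i + 1) x| ^ (β n i)⁻¹) := by gcongr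
    _ = 2 * |ω n l (i + 1) x| ^ (1 + (β n i)⁻¹) := by
      rw [Real.rpow_one_add' (abs_nonneg _) h3.ne']; ring

end design

/-! ### Homogeneity -/

/-- The anisotropic dilation `x_i ↦ r^{p_i} x_i`. -/
def dil (n : ℕ) (r : ℝ) : (Fin n → ℝ) →L[ℝ] (Fin n → ℝ) :=
  ContinuousLinearMap.pi fun k => (r ^ p n (k + 1)) • ContinuousLinearMap.proj k

/-- `f` is homogeneous of degree `m` for the dilations `dil`. -/
def IsHom {n : ℕ} (f : (Fin n → ℝ) → ℝ) (m : ℝ) : Prop :=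
  ∀ r : ℝ, 0 < r → ∀ x, f (dil n r x) = r ^ m * f x

theorem dil_apply {n : ℕ} (r : ℝ) (x : Fin n → ℝ) (k : Fin n) :
    dil n r x k = r ^ p n (k + 1) * x k := rfl

theorem coord_smul {n : ℕ} (c : ℝ) (x : Fin n → ℝ) (i : ℕ) :
    coord (c • x) i = c * coord x i := by
  simp only [← coordL_apply, map_smul, smul_eq_mul]

theorem isHom_coord (n i : ℕ) : IsHom (fun x : Fin n → ℝ => coord x i) (p n i) := by
  intro r _ x
  by_cases h : 1 ≤ i ∧ i ≤ n
  · have h2 : i - 1 + 1 = i := by omega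
    simp [coord, h, dil_apply, h2]
  · simp [coord, h]

theorem coord_dil {n : ℕ} {r : ℝ} (hr : 0 < r) (x : Fin n → ℝ) (i : ℕ) :
    coord (dil n r x) i = r ^ p n i * coord x i := isHom_coord n i r hr x

section hom

variable {n : ℕ} {f g : (Fin n → ℝ) → ℝ} {m m' : ℝ}

theorem IsHom.congr_deg (hf : IsHom f m) (h : m = m') : IsHom f m' := h ▸ hf

theorem IsHom.sub (hf : IsHom f m) (hg : IsHom g m) : IsHom (fun x => f x - g x) m :=
  fun r hr x => by simp only [hf r hr x, hg r hr x, mul_sub]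

theorem IsHom.const_mul (c : ℝ) (hf : IsHom f m) : IsHom (fun x => c * f x) m :=
  fun r hr x => by simp only [hf r hr x]; ring

theorem IsHom.mul (hf : IsHom f m) (hg : IsHom g m') : IsHom (fun x => f x * g x) (m + m') :=
  fun r hr x => by simp only [hf r hr x, hg r hr x, Real.rpow_add hr]; ring

theorem IsHom.spow (hf : IsHom f m) (a : ℝ) : IsHom (fun x => spow (f x) a) (m * a) :=
  fun r hr x => by
    simp only [hf r hr x, spow_mul, spow_of_pos (Real.rpow_pos_of_pos hr m), Real.rpow_mul hr.le]

theorem IsHom.abs_rpow (hf : IsHom f m) (a : ℝ) : IsHom (fun x => |f x| ^ a) (m * a) :=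
  fun r hr x => by
    have h := Real.rpow_pos_of_pos hr m
    simp only [hf r hr x, abs_mul, abs_of_pos h, Real.mul_rpow h.le (abs_nonneg _),
      Real.rpow_mul hr.le]

theorem IsHom.rpow (hf : IsHom f m) (h0 : ∀ x, 0 ≤ f x) (a : ℝ) :
    IsHom (fun x => f x ^ a) (m * a) := by
  simpa only [abs_of_nonneg (h0 _)] using hf.abs_rpow a

theorem IsHom.sum {ι : Type*} {F : ι → (Fin n → ℝ) → ℝ} (s : Finset ι)
    (h : ∀ j ∈ s, IsHom (F j) m) : IsHom (fun x => ∑ j ∈ s, F j x) m := fun r hr x => by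
  simp only [Finset.mul_sum]
  exact Finset.sum_congr rfl fun j hj => h j hj r hr x

theorem IsHom.fderiv_dil (hf : IsHom f m) (hd : Differentiable ℝ f) {r : ℝ} (hr : 0 < r)
    (x w : Fin n → ℝ) : fderiv ℝ f (dil n r x) (dil n r w) = r ^ m * fderiv ℝ f x w := by
  have h1 : HasFDerivAt (f ∘ dil n r) ((fderiv ℝ f (dil n r x)).comp (dil n r)) x :=
    (hd _).hasFDerivAt.comp x (dil n r).hasFDerivAt
  have h2 : HasFDerivAt (f ∘ dil n r) (r ^ m • fderiv ℝ f x) x :=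
    ((hd x).hasFDerivAt.const_mul (r ^ m)).congr_of_eventuallyEq (.of_forall fun y => hf r hr y)
  have := congrArg (fun L => L w) (h1.unique h2)
  simpa using this

end hom

theorem coord_mulVec_J {n : ℕ} (x : Fin n → ℝ) (i : ℕ) :
    coord ((J n).mulVec x) (i + 1) = coord x (i + 2) := by
  by_cases h : i + 1 ≤ n
  · rw [coord, dif_pos ⟨by omega, h⟩]
    simp only [Matrix.mulVec, dotProduct, J, Matrix.of_apply, ite_mul, one_mul, zero_mul,
      add_tsub_cancel_right]
    by_cases h2 : i + 2 ≤ n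
    · rw [coord, dif_pos ⟨by omega, h2⟩, Finset.sum_eq_single ⟨i + 1, by omega⟩]
      · simp
      · intro b _ hb
        rw [if_neg fun hc => hb (Fin.ext hc)]
      · simp
    · rw [coord, dif_neg (by omega)]
      refine Finset.sum_eq_zero fun b _ => if_neg ?_
      have := b.2
      omega
  · rw [coord, coord, dif_neg (by omega), dif_neg (by omega)]

theorem mulVec_J_dil {n : ℕ} {r : ℝ} (hr : 0 < r) (x : Fin n → ℝ) :
    (J n).mulVec (dil n r x) = r ^ (-(1 / n : ℝ)) • dil n r ((J n).mulVec x) := by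
  refine ext_coord fun i _ => ?_
  rw [coord_mulVec_J, coord_smul, coord_dil hr, coord_dil hr, coord_mulVec_J,
    ← mul_assoc, ← Real.rpow_add hr, p_add_two]
  congr 2
  ring

/-- The drift derivative lowers the degree of homogeneity by `1/n`. -/
theorem IsHom.fderiv_J {n : ℕ} {f : (Fin n → ℝ) → ℝ} {m : ℝ} (hf : IsHom f m)
    (hd : Differentiable ℝ f) :
    IsHom (fun x => fderiv ℝ f x ((J n).mulVec x)) (m - 1 / n) := fun r hr x => by
  simp only [mulVec_J_dil hr, map_smul, hf.fderiv_dil hd hr, smul_eq_mul, sub_eq_add_neg,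
    Real.rpow_add hr]
  ring

theorem continuous_fderiv_J {n : ℕ} {f : (Fin n → ℝ) → ℝ} (hf : ContDiff ℝ 1 f) :
    Continuous fun x => fderiv ℝ f x ((J n).mulVec x) :=
  (hf.continuous_fderiv one_ne_zero).clm_apply
    (Continuous.matrix_mulVec continuous_const continuous_id)

/-- A homogeneous norm for the dilations `dil`. -/
def homNorm (n : ℕ) (x : Fin n → ℝ) : ℝ := ∑ k : Fin n, |x k| ^ (p n (k + 1))⁻¹

theorem continuous_homNorm (n : ℕ) : Continuous (homNorm n) :=
  continuous_finsetSum _ fun k _ => (continuous_apply k).abs.rpow_const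
    fun _ => Or.inr (inv_nonneg.2 (p_succ_pos k.2).le)

theorem homNorm_dil {n : ℕ} {r : ℝ} (hr : 0 < r) (x : Fin n → ℝ) :
    homNorm n (dil n r x) = r * homNorm n x := by
  simp only [homNorm, Finset.mul_sum]
  refine Finset.sum_congr rfl fun k _ => ?_
  have h := p_succ_pos k.2
  rw [dil_apply, abs_mul, abs_of_pos (Real.rpow_pos_of_pos hr _),
    Real.mul_rpow (Real.rpow_nonneg hr.le _) (abs_nonneg _), ← Real.rpow_mul hr.le,
    mul_inv_cancel₀ h.ne', Real.rpow_one]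

theorem homNorm_pos {n : ℕ} {x : Fin n → ℝ} (hx : x ≠ 0) : 0 < homNorm n x := by
  obtain ⟨k, hk⟩ := Function.ne_iff.1 hx
  exact Finset.sum_pos' (fun j _ => Real.rpow_nonneg (abs_nonneg _) _)
    ⟨k, Finset.mem_univ k, Real.rpow_pos_of_pos (abs_pos.2 hk) _⟩

theorem isCompact_homSphere (n : ℕ) : IsCompact {x : Fin n → ℝ | homNorm n x = 1} := by
  refine (isCompact_closedBall (0 : Fin n → ℝ) 1).of_isClosed_subset
    (isClosed_eq (continuous_homNorm n) continuous_const) fun x hx => ?_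
  rw [mem_closedBall_zero_iff, pi_norm_le_iff_of_nonneg zero_le_one]
  intro k
  rw [Real.norm_eq_abs]
  have h1 : |x k| ^ (p n (k + 1))⁻¹ ≤ 1 := by
    rw [← show homNorm n x = 1 from hx]
    exact Finset.single_le_sum (f := fun k : Fin n => |x k| ^ (p n (k + 1))⁻¹)
      (fun j _ => Real.rpow_nonneg (abs_nonneg _) _) (Finset.mem_univ k)
  by_contra! h
  exact absurd h1 (not_le.2 (Real.one_lt_rpow h (inv_pos.2 (p_succ_pos k.2))))

/-- If `f` is negative on the zero set of `g ≥ 0`, with `f`, `g`, `h` continuous and homogeneous of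
the same positive degree, then `f ≤ -c h + K g`. -/
theorem IsHom.exists_le {n : ℕ} {f g h : (Fin n → ℝ) → ℝ} {m : ℝ} (hm : 0 < m)
    (hf : IsHom f m) (hg : IsHom g m) (hh : IsHom h m)
    (hfc : Continuous f) (hgc : Continuous g) (hhc : Continuous h)
    (hg0 : ∀ x, 0 ≤ g x) (hh0 : ∀ x, 0 ≤ h x)
    {T : Set (Fin n → ℝ)} (hTc : IsClosed T) (hT : ∀ r : ℝ, 0 < r → ∀ x ∈ T, dil n r x ∈ T)
    (hneg : ∀ x ∈ T, x ≠ 0 → g x = 0 → f x < 0) :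
    ∃ K c : ℝ, 0 < K ∧ 0 < c ∧ ∀ x ∈ T, f x ≤ -c * h x + K * g x := by
  have hcomp : IsCompact ({x : Fin n → ℝ | homNorm n x = 1} ∩ T) :=
    (isCompact_homSphere n).inter_right hTc
  -- The sets increase with k and cover the sphere within T: where g > 0 the multiple of g wins, and
  -- where g = 0 the strict inequality f < 0 absorbs a small multiple of h. Compactness selects one
  -- k.
  let U : ℕ → Set (Fin n → ℝ) := fun k => {x | f x + 1 / ((k : ℝ) + 1) * h x < ((k : ℝ) + 1) * g x}
  obtain ⟨k, hk⟩ := hcomp.elim_directed_cover U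
    (fun k => isOpen_lt (hfc.add (continuous_const.mul hhc)) (continuous_const.mul hgc))
    (by
      rintro x ⟨hx1, hxT⟩
      have hx0 : x ≠ 0 := by
        rintro rfl
        have : homNorm n (dil n 2 0) = 2 * homNorm n 0 := homNorm_dil two_pos 0
        rw [map_zero, show homNorm n 0 = 1 from hx1] at this
        norm_num at this
      rw [Set.mem_iUnion]
      have hlim : Tendsto (fun k : ℕ => f x + 1 / ((k : ℝ) + 1) * h x) atTop (𝓝 (f x + 0 * h x)) :=
        tendsto_const_nhds.add (tendsto_one_div_add_atTop_nhds_zero_nat.mul_const _)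
      rw [zero_mul, add_zero] at hlim
      rcases (hg0 x).eq_or_lt with h0 | h0
      · obtain ⟨k, hk⟩ := (hlim.eventually_lt_const (hneg x hxT hx0 h0.symm)).exists
        exact ⟨k, by simpa [U, ← h0] using hk⟩
      · have h1 : Tendsto (fun k : ℕ => ((k : ℝ) + 1) * g x) atTop atTop :=
          (tendsto_atTop_add_const_right _ 1 tendsto_natCast_atTop_atTop).atTop_mul_const h0
        obtain ⟨k, hk1, hk2⟩ := ((hlim.eventually_lt_const (lt_add_one (f x))).and
          (h1.eventually_ge_atTop (f x + 1))).exists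
        exact ⟨k, hk1.trans_le hk2⟩)
    (Monotone.directed_le fun i j hij x hx => by
      have hij' : (i : ℝ) + 1 ≤ (j : ℝ) + 1 := by exact_mod_cast Nat.succ_le_succ hij
      have h1 : 1 / ((j : ℝ) + 1) * h x ≤ 1 / ((i : ℝ) + 1) * h x :=
        mul_le_mul_of_nonneg_right (one_div_le_one_div_of_le (by positivity) hij') (hh0 x)
      have h2 := mul_le_mul_of_nonneg_right hij' (hg0 x)
      have h3 : f x + 1 / ((i : ℝ) + 1) * h x < ((i : ℝ) + 1) * g x := hx
      change f x + 1 / ((j : ℝ) + 1) * h x < ((j : ℝ) + 1) * g x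
      linarith)
  refine ⟨(k : ℝ) + 1, 1 / ((k : ℝ) + 1), by positivity, by positivity, fun x hx => ?_⟩
  rcases eq_or_ne x 0 with rfl | hx0
  -- A positive degree forces the value 0 at the origin.
  · have hz : ∀ F : (Fin n → ℝ) → ℝ, IsHom F m → F 0 = 0 := fun F hF => by
      have h1 := hF 2 two_pos 0
      rw [map_zero] at h1
      have h2 : (1 : ℝ) < 2 ^ m := Real.one_lt_rpow one_lt_two hm
      have h3 : (2 ^ m - 1) * F 0 = 0 := by linarith
      exact (mul_eq_zero.1 h3).resolve_left (by linarith)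
    simp [hz f hf, hz g hg, hz h hh]
  · have hr := homNorm_pos hx0
    set r := homNorm n x
    have hy : dil n r⁻¹ x ∈ U k := hk
      ⟨by rw [Set.mem_ofPred_eq, homNorm_dil (inv_pos.2 hr)]; exact inv_mul_cancel₀ hr.ne',
        hT _ (inv_pos.2 hr) x hx⟩
    have hy' : f (dil n r⁻¹ x) + 1 / ((k : ℝ) + 1) * h (dil n r⁻¹ x) <
      ((k : ℝ) + 1) * g (dil n r⁻¹ x) := hy
    rw [hf _ (inv_pos.2 hr), hg _ (inv_pos.2 hr), hh _ (inv_pos.2 hr)] at hy'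
    have hpos : 0 < r⁻¹ ^ m := Real.rpow_pos_of_pos (inv_pos.2 hr) m
    have h5 : r⁻¹ ^ m * (f x + 1 / ((k : ℝ) + 1) * h x) < r⁻¹ ^ m * (((k : ℝ) + 1) * g x) := by
      linarith
    have := lt_of_mul_lt_mul_left h5 hpos.le
    linarith

section designHom

variable {n : ℕ} {l : ℕ → ℝ}

theorem isHom_v (hn : 2 ≤ n) : ∀ i, i ≤ n → IsHom (fun x => v n l x i) (p n (i + 1)) := by
  intro i
  induction i with
  | zero => exact fun _ r hr x => by simp only [v_zero, mul_zero]
  | succ i ih =>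
    intro hi
    simp only [v_succ]
    have h := (((isHom_coord n (i + 1)).spow (β n i)).sub ((ih (by omega)).spow (β n i))).spow
      (feedbackExp n i)
    exact (h.congr_deg (mul_feedbackExp hn hi)).const_mul _

theorem isHom_vpow (hn : 2 ≤ n) {i : ℕ} (hi : i ≤ n) :
    IsHom (vpow n l i) (p n (i + 1) * β n i) := (isHom_v hn i hi).spow _

theorem isHom_ω (hn : 2 ≤ n) {i : ℕ} (hi : i < n) :
    IsHom (ω n l (i + 1)) (p n (i + 1) * β n i) :=
  ((isHom_coord n (i + 1)).spow _).sub (isHom_vpow hn hi.le)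

theorem isHom_W (hn : 2 ≤ n) {i : ℕ} (hi : i < n) :
    IsHom (W n l (i + 1)) ((2 * (n : ℝ) - 1) / n) := by
  have h1 := isHom_coord n (i + 1)
  have h2 := isHom_v (l := l) hn i hi.le
  have h3 := ((h1.abs_rpow (β n i + 1)).sub (h2.abs_rpow (β n i + 1))).const_mul (β n i + 1)⁻¹
  have h4 := ((h2.spow (β n i)).mul (h1.sub h2)).congr_deg
    (by ring : _ = p n (i + 1) * (β n i + 1))
  have h5 := (h3.sub h4).congr_deg (p_mul_β_add_one hi)
  intro r hr x
  simpa only [W_succ, bregman, div_eq_inv_mul _ (β n i + 1)] using h5 r hr x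

theorem isHom_Vpart (hn : 2 ≤ n) {i : ℕ} (hi : i ≤ n) :
    IsHom (Vpart n l i) ((2 * (n : ℝ) - 1) / n) := by
  refine IsHom.sum _ fun j hj => ?_
  rw [Finset.mem_Icc] at hj
  obtain ⟨k, rfl⟩ : ∃ k, j = k + 1 := ⟨j - 1, by omega⟩
  exact isHom_W hn (by omega)

end designHom

/-! ### Truncation -/

/-- The projection to the first `j` coordinates. -/
def trunc (n j : ℕ) : (Fin n → ℝ) →L[ℝ] (Fin n → ℝ) :=
  ContinuousLinearMap.pi fun k => if (k : ℕ) < j then ContinuousLinearMap.proj k else 0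

theorem coord_trunc {n : ℕ} (j : ℕ) (x : Fin n → ℝ) (i : ℕ) :
    coord (trunc n j x) (i + 1) = if i < j then coord x (i + 1) else 0 := by
  by_cases h : i + 1 ≤ n <;> by_cases h2 : i < j <;> simp [coord, trunc, h, h2]

theorem trunc_trunc {n i j : ℕ} (hij : i ≤ j) (x : Fin n → ℝ) :
    trunc n i (trunc n j x) = trunc n i x := by
  refine ext_coord fun k _ => ?_
  simp only [coord_trunc]
  by_cases h : k < i
  · simp [h, h.trans_le hij]
  · simp [h]

theorem trunc_mulVec_J {n : ℕ} (j : ℕ) (x : Fin n → ℝ) :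
    trunc n j ((J n).mulVec (trunc n (j + 1) x)) = trunc n j ((J n).mulVec x) := by
  refine ext_coord fun k _ => ?_
  rw [coord_trunc, coord_trunc, coord_mulVec_J, coord_mulVec_J, coord_trunc]
  by_cases h : k < j <;> simp [h]

theorem trunc_eLast {n j : ℕ} (hj : j < n) : trunc n j (eLast n) = 0 := by
  ext k
  by_cases h : (k : ℕ) < j
  · have : (k : ℕ) + 1 ≠ n := by omega
    simp [trunc, h, eLast, this]
  · simp [trunc, h]

theorem trunc_dil {n : ℕ} (j : ℕ) (r : ℝ) (x : Fin n → ℝ) :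
    trunc n j (dil n r x) = dil n r (trunc n j x) := by
  ext k
  by_cases h : (k : ℕ) < j <;> simp [trunc, dil, h]

theorem fderiv_trunc {n j : ℕ} {f : (Fin n → ℝ) → ℝ} (hf : Differentiable ℝ f)
    (h : ∀ x, f (trunc n j x) = f x) (x w : Fin n → ℝ) :
    fderiv ℝ f x w = fderiv ℝ f (trunc n j x) (trunc n j w) := by
  have h1 : HasFDerivAt f ((fderiv ℝ f (trunc n j x)).comp (trunc n j)) x :=
    ((hf _).hasFDerivAt.comp x (trunc n j).hasFDerivAt).congr_of_eventuallyEq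
      (.of_forall fun y => (h y).symm)
  rw [h1.fderiv]
  rfl

/-- The first j components of J x involve only the first j + 1 coordinates of x, because J shifts
indices by one. -/
theorem fderiv_J_trunc {n j : ℕ} {f : (Fin n → ℝ) → ℝ} (hf : Differentiable ℝ f)
    (h : ∀ x, f (trunc n j x) = f x) (x : Fin n → ℝ) :
    fderiv ℝ f (trunc n (j + 1) x) ((J n).mulVec (trunc n (j + 1) x)) =
      fderiv ℝ f x ((J n).mulVec x) := by
  rw [fderiv_trunc hf h, trunc_trunc (by omega), trunc_mulVec_J, ← fderiv_trunc hf h]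

theorem fderiv_eLast {n j : ℕ} (hj : j < n) {f : (Fin n → ℝ) → ℝ} (hf : Differentiable ℝ f)
    (h : ∀ x, f (trunc n j x) = f x) (x : Fin n → ℝ) : fderiv ℝ f x (eLast n) = 0 := by
  rw [fderiv_trunc hf h, trunc_eLast hj, map_zero]

section designTrunc

variable {n : ℕ} {l : ℕ → ℝ}

theorem v_trunc (j : ℕ) (x : Fin n → ℝ) : ∀ i, i ≤ j → v n l (trunc n j x) i = v n l x i := by
  intro i
  induction i with
  | zero => simp [v_zero]
  | succ i ih =>
    intro hi
    rw [v_succ, v_succ, ω_succ, ω_succ, vpow, vpow, ih (by omega), coord_trunc, if_pos (by omega)]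

theorem ω_trunc {i j : ℕ} (hij : i < j) (x : Fin n → ℝ) :
    ω n l (i + 1) (trunc n j x) = ω n l (i + 1) x := by
  rw [ω_succ, ω_succ, vpow, vpow, v_trunc j x i hij.le, coord_trunc, if_pos hij]

theorem vpow_trunc {i j : ℕ} (hij : i ≤ j) (x : Fin n → ℝ) :
    vpow n l i (trunc n j x) = vpow n l i x := by
  rw [vpow, vpow, v_trunc j x i hij]

theorem Vpart_trunc {i j : ℕ} (hij : i ≤ j) (x : Fin n → ℝ) :
    Vpart n l i (trunc n j x) = Vpart n l i x := by
  refine Finset.sum_congr rfl fun k hk => ?_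
  rw [Finset.mem_Icc] at hk
  obtain ⟨k, rfl⟩ : ∃ m, k = m + 1 := ⟨k - 1, by omega⟩
  rw [W_succ, W_succ, v_trunc j x k (by omega), coord_trunc, if_pos (by omega)]

end designTrunc

/-! ### Lyapunov pairs -/

section congr

variable {n : ℕ} {l l' : ℕ → ℝ}

theorem v_congr {i : ℕ} (h : ∀ j ≤ i, l j = l' j) (x : Fin n → ℝ) : v n l x i = v n l' x i := by
  induction i with
  | zero => simp [v_zero]
  | succ i ih =>
    rw [v_succ, v_succ, ω_succ, ω_succ, vpow, vpow, ih fun j hj => h j (by omega), h _ le_rfl]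

theorem ω_congr {i : ℕ} (h : ∀ j ≤ i, l j = l' j) : ω n l (i + 1) = ω n l' (i + 1) :=
  funext fun x => by rw [ω_succ, ω_succ, vpow, vpow, v_congr h]

theorem Vpart_congr {i : ℕ} (h : ∀ j ≤ i, l j = l' j) : Vpart n l i = Vpart n l' i :=
  funext fun x => Finset.sum_congr rfl fun k hk => by
    rw [Finset.mem_Icc] at hk
    obtain ⟨k, rfl⟩ : ∃ m, k = m + 1 := ⟨k - 1, by omega⟩
    rw [W_succ, W_succ, v_congr fun j hj => h j (by omega)]

end congr

section

variable {n : ℕ} {l : ℕ → ℝ}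

theorem fderiv_Vpart_succ_J {i : ℕ} (hn : 2 ≤ n) (hi : i < n) (x : Fin n → ℝ) :
    fderiv ℝ (Vpart n l (i + 1)) x ((J n).mulVec x) =
      fderiv ℝ (Vpart n l i) x ((J n).mulVec x) -
        (coord x (i + 1) - v n l x i) * fderiv ℝ (vpow n l i) x ((J n).mulVec x) +
        ω n l (i + 1) x * coord x (i + 2) := by
  rw [fderiv_Vpart_succ hn hi, fderiv_W hn hi, coord_mulVec_J]
  ring

/-- This is the dissipation produced when x_{i+2} in the derivative of V_{i+1} is replaced by the
virtual feedback v_{i+1}. -/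
theorem neg_ω_mul_v {i : ℕ} (hn : 2 ≤ n) (hi : i < n) (x : Fin n → ℝ) :
    -(ω n l (i + 1) x * v n l x (i + 1)) =
      l (i + 1) * |ω n l (i + 1) x| ^ (feedbackExp n i + 1) := by
  rw [v_succ, ← mul_spow _ (feedbackExp_nonneg hn hi)]
  ring

theorem two_mul_sub_two_div_pos (hn : 2 ≤ n) : 0 < (2 * (n : ℝ) - 2) / n := by
  have : (2 : ℝ) ≤ n := by exact_mod_cast hn
  exact div_pos (by linarith) (by linarith)

theorem isHom_Vpart_rpow (hn : 2 ≤ n) {i : ℕ} (hi : i ≤ n) :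
    IsHom (fun x => Vpart n l i x ^ α n) ((2 * (n : ℝ) - 2) / n) :=
  ((isHom_Vpart hn hi).rpow (Vpart_nonneg hn hi) (α n)).congr_deg (mul_α hn)

theorem continuous_Vpart_rpow (hn : 2 ≤ n) {i : ℕ} (hi : i ≤ n) :
    Continuous fun x => Vpart n l i x ^ α n :=
  (contDiff_Vpart hn hi).continuous.rpow_const fun _ => Or.inr (α_pos hn).le

theorem isHom_fderiv_Vpart_J (hn : 2 ≤ n) {i : ℕ} (hi : i ≤ n) :
    IsHom (fun x => fderiv ℝ (Vpart n l i) x ((J n).mulVec x)) ((2 * (n : ℝ) - 2) / n) :=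
  ((isHom_Vpart hn hi).fderiv_J ((contDiff_Vpart hn hi).differentiable one_ne_zero)).congr_deg
    (by ring)

/-- One step of the recursive choice of the gains. -/
theorem exists_gain {i : ℕ} (hn : 2 ≤ n) (hi : i < n) {c : ℝ} (hc : 0 < c)
    (hx : ∀ x, fderiv ℝ (Vpart n l i) x ((J n).mulVec x) ≤
      -c * Vpart n l i x ^ α n + ω n l i x * (coord x (i + 1) - v n l x i)) :
    ∃ K c' : ℝ, 0 < K ∧ 0 < c' ∧ ∀ x : Fin n → ℝ, fderiv ℝ (Vpart n l i) x ((J n).mulVec x) -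
        (coord x (i + 1) - v n l x i) * fderiv ℝ (vpow n l i) x ((J n).mulVec x) ≤
      -c' * Vpart n l (i + 1) x ^ α n + K * |ω n l (i + 1) x| ^ (feedbackExp n i + 1) := by
  have hzC := contDiff_vpow (l := l) hn i hi
  have hVC := contDiff_Vpart (l := l) hn hi.le
  have hzd := hzC.differentiable one_ne_zero
  have hVd := hVC.differentiable one_ne_zero
  have hf : IsHom (fun x => fderiv ℝ (Vpart n l i) x ((J n).mulVec x) -
      (coord x (i + 1) - v n l x i) * fderiv ℝ (vpow n l i) x ((J n).mulVec x))
      ((2 * (n : ℝ) - 2) / n) := by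
    refine (isHom_fderiv_Vpart_J hn hi.le).sub
      ((((isHom_coord n (i + 1)).sub (isHom_v hn i hi.le)).mul
        ((isHom_vpow hn hi.le).fderiv_J hzd)).congr_deg ?_)
    have := p_mul_β_add_one hi
    linear_combination this
  have hg : IsHom (fun x => |ω n l (i + 1) x| ^ (feedbackExp n i + 1))
      ((2 * (n : ℝ) - 2) / n) := by
    refine ((isHom_ω hn hi).abs_rpow _).congr_deg ?_
    have h1 := p_mul_β_add_one hi
    have h2 := mul_feedbackExp hn hi
    have h3 := p_add_two n i
    linear_combination h1 + h2 + h3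
  have he : 0 ≤ feedbackExp n i + 1 := by linarith [feedbackExp_nonneg hn hi]
  -- The restriction to vectors supported on the first i + 1 coordinates is essential: other nonzero
  -- vectors can have V_i = 0. On the restricted set, ω_{i+1} = 0 and V_i = 0 together force x = 0.
  have hneg : ∀ x ∈ {x | trunc n (i + 1) x = x}, x ≠ 0 →
      |ω n l (i + 1) x| ^ (feedbackExp n i + 1) = 0 →
      fderiv ℝ (Vpart n l i) x ((J n).mulVec x) -
      (coord x (i + 1) - v n l x i) * fderiv ℝ (vpow n l i) x ((J n).mulVec x) < 0 := by
    intro x hxT hx0 hω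
    have hω0 : ω n l (i + 1) x = 0 := by
      by_contra h
      exact (Real.rpow_pos_of_pos (abs_pos.2 h) _).ne' hω
    have hxv := (ω_eq_zero_iff hn hi).1 hω0
    have h1 := hx x
    rw [hxv, sub_self, mul_zero, add_zero] at h1
    rw [hxv, sub_self, zero_mul, sub_zero]
    refine h1.trans_lt ?_
    rw [neg_mul, neg_lt_zero]
    refine mul_pos hc (Real.rpow_pos_of_pos ?_ _)
    refine lt_of_le_of_ne (Vpart_nonneg hn hi.le x) fun h0 => hx0 ?_
    obtain ⟨h2, h3⟩ := eq_zero_of_Vpart_eq_zero hn i hi.le h0.symm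
    have h4 : coord x (i + 1) = 0 := by rw [hxv, h3]
    refine ext_coord fun j _ => ?_
    rw [← show trunc n (i + 1) x = x from hxT, coord_trunc]
    have : coord (0 : Fin n → ℝ) (j + 1) = 0 := by simp [← coordL_apply]
    rw [this]
    split_ifs with hj
    · rcases Nat.lt_succ_iff_lt_or_eq.1 hj with h | rfl
      · exact h2 j h
      · exact h4
    · rfl
  obtain ⟨K, c', hK, hc', h⟩ := IsHom.exists_le (two_mul_sub_two_div_pos hn) hf hg
    (isHom_Vpart_rpow hn hi)
    ((continuous_fderiv_J hVC).sub (((contDiff_coord n (i + 1)).continuous.sub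
      (continuous_v hn hi)).mul (continuous_fderiv_J hzC)))
    ((continuous_ω hn hi).abs.rpow_const fun _ => Or.inr he)
    (continuous_Vpart_rpow hn hi)
    (fun x => Real.rpow_nonneg (abs_nonneg _) _)
    (fun x => Real.rpow_nonneg (Vpart_nonneg hn hi x) _)
    (isClosed_eq (trunc n (i + 1)).continuous continuous_id)
    (fun r _ x hx => by rw [Set.mem_ofPred_eq, trunc_dil, show trunc n (i + 1) x = x from hx]; rfl)
    hneg
  refine ⟨K, c', hK, hc', fun x => ?_⟩
  -- Every term depends on the first i + 1 coordinates only, so the inequality at the truncated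
  -- point is the one at x.
  have h5 := h (trunc n (i + 1) x) (trunc_trunc le_rfl x)
  rwa [fderiv_J_trunc hVd (Vpart_trunc le_rfl), fderiv_J_trunc hzd (vpow_trunc le_rfl),
    coord_trunc, if_pos (Nat.lt_succ_self i), v_trunc _ _ _ (Nat.le_succ i),
    Vpart_trunc le_rfl, ω_trunc (Nat.lt_succ_self i)] at h5

end

/-- The recursive design: each `x_{i+1}` is a virtual input of the subsystem `x_1, …, x_i`. -/
theorem exists_gains {n : ℕ} (hn : 2 ≤ n) : ∀ i, i ≤ n → ∃ (l : ℕ → ℝ) (c : ℝ),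
    (∀ j, 0 < l j) ∧ 0 < c ∧ ∀ x : Fin n → ℝ,
      fderiv ℝ (Vpart n l i) x ((J n).mulVec x) ≤
        -c * Vpart n l i x ^ α n + ω n l i x * (coord x (i + 1) - v n l x i) := by
  intro i
  induction i with
  | zero =>
    refine fun _ => ⟨fun _ => 1, 1, fun _ => one_pos, one_pos, fun x => ?_⟩
    have : Vpart n (fun _ => 1) 0 = fun _ => 0 := funext (Vpart_zero n _)
    rw [this]
    simp [ω_zero, Real.zero_rpow (α_pos hn).ne']
  | succ i ih =>
    intro hi
    obtain ⟨l, c, hl, hc, hx⟩ := ih (by omega)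
    obtain ⟨K, c', hK, hc', h⟩ := exists_gain hn hi hc hx
    -- With l_{i+1} = K, the dissipation cancels the term K|ω_{i+1}|^(...) exactly. Neither ω_{i+1}
    -- nor V_{i+1} involves l_{i+1}, so the earlier estimate survives the change of gain.
    refine ⟨Function.update l (i + 1) K, c', fun j => ?_, hc', fun x => ?_⟩
    · rcases eq_or_ne j (i + 1) with rfl | hj
      · simpa using hK
      · simpa [hj] using hl j
    · have hcongr : ∀ j ≤ i, Function.update l (i + 1) K j = l j := fun j hj =>
        Function.update_of_ne (by omega) _ _
      have hV : Vpart n (Function.update l (i + 1) K) (i + 1) = Vpart n l (i + 1) := by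
        ext x
        rw [Vpart_succ, Vpart_succ, Vpart_congr hcongr, W_succ, W_succ, v_congr hcongr]
      have h1 := neg_ω_mul_v (l := Function.update l (i + 1) K) hn hi x
      rw [ω_congr hcongr, Function.update_self] at h1
      rw [hV, ω_congr hcongr, fderiv_Vpart_succ_J hn hi]
      linarith [h x]

/-- Only W_n depends on x_n, and its partial derivative in x_n is ω_n. -/
theorem fderiv_V_eLast {n : ℕ} {l : ℕ → ℝ} (hn : 2 ≤ n) (x : Fin n → ℝ) :
    fderiv ℝ (V n l) x (eLast n) = ω n l n x := by
  obtain ⟨m, rfl⟩ : ∃ m, n = m + 1 := ⟨n - 1, by omega⟩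
  have hm : m < m + 1 := Nat.lt_succ_self m
  rw [← Vpart_self, fderiv_Vpart_succ hn hm, fderiv_W hn hm,
    fderiv_eLast hm ((contDiff_vpow hn m hm).differentiable one_ne_zero) (vpow_trunc le_rfl),
    fderiv_eLast hm ((contDiff_Vpart hn hm.le).differentiable one_ne_zero) (Vpart_trunc le_rfl)]
  simp [coord, eLast]

theorem mul_sign (x : ℝ) : x * Real.sign x = |x| := by
  rcases lt_trichotomy x 0 with h | rfl | h
  · rw [Real.sign_of_neg h, abs_of_neg h]; ring
  · simp
  · rw [Real.sign_of_pos h, abs_of_pos h]; ring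

theorem hasFDerivAt_V {n : ℕ} (l : ℕ → ℝ) (hn : 2 ≤ n) (x : Fin n → ℝ) :
    HasFDerivAt (V n l) (fderiv ℝ (V n l) x) x :=
  ((contDiff_Vpart hn le_rfl).differentiable one_ne_zero x).hasFDerivAt

theorem V_nonneg {n : ℕ} (l : ℕ → ℝ) (hn : 2 ≤ n) (x : Fin n → ℝ) : 0 ≤ V n l x :=
  Vpart_nonneg hn le_rfl x

/-- The Lyapunov inequality with the input eliminated. -/
theorem isLyapunovPair_iff {n : ℕ} {l : ℕ → ℝ} {c : ℝ} (hn : 2 ≤ n) :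
    IsLyapunovPair n l c ↔ (∀ i, 1 ≤ i → i ≤ n → 0 < l i) ∧ 0 < c ∧ ∀ x : Fin n → ℝ,
      fderiv ℝ (V n l) x ((J n).mulVec x) ≤ -c * V n l x ^ α n + l n * |ω n l n x| := by
  refine and_congr_right fun _ => and_congr_right fun _ => ⟨fun h x => ?_, fun h x u => ?_⟩
  · obtain ⟨V', hV', h1⟩ := h x 0
    rw [← hV'.fderiv, zero_smul, add_zero, zero_add] at h1
    rw [← mul_sign]
    linarith
  · refine ⟨_, hasFDerivAt_V l hn x, ?_⟩
    rw [map_add, map_smul, fderiv_V_eLast hn, smul_eq_mul]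
    have := h x
    rw [← mul_sign] at this
    linarith

theorem exists_isLyapunovPair {n : ℕ} (hn : 2 ≤ n) :
    ∃ (l : ℕ → ℝ) (c : ℝ), IsLyapunovPair n l c := by
  obtain ⟨l, c, hl, hc, h⟩ := exists_gains hn n le_rfl
  refine ⟨l, c, (isLyapunovPair_iff hn).2 ⟨fun i _ _ => hl i, hc, fun x => ?_⟩⟩
  obtain ⟨m, rfl⟩ : ∃ m, n = m + 1 := ⟨n - 1, by omega⟩
  have h1 := h x
  have h2 := neg_ω_mul_v (l := l) hn (Nat.lt_succ_self m) x
  -- Coordinate n + 1 is 0 by the default value in `coord`, and the last feedback exponent is 0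
  -- because p_{n+1} = 0. Thus the last virtual input becomes -l_n sign(ω_n).
  have h3 : coord x (m + 1 + 1) = 0 := by simp [coord]
  have h4 : feedbackExp (m + 1) m = 0 := by
    have : p (m + 1) (m + 2) = 0 := by
      rw [p_succ_eq (m + 1) (m + 1) (by omega)]
      simp
    rw [feedbackExp, this, zero_div]
  rw [h4, zero_add, Real.rpow_one] at h2
  rw [h3, Vpart_self] at h1
  linarith

theorem IsLyapunovPair.mono {n : ℕ} {l : ℕ → ℝ} {c c' : ℝ} (hn : 2 ≤ n)
    (h : IsLyapunovPair n l c) (h0 : 0 < c') (hc : c' ≤ c) : IsLyapunovPair n l c' := by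
  rw [isLyapunovPair_iff hn] at h ⊢
  refine ⟨h.1, h0, fun x => (h.2.2 x).trans ?_⟩
  have := mul_le_mul_of_nonneg_right hc (Real.rpow_nonneg (V_nonneg l hn x) (α n))
  linarith

/-- Along the subsystem `x_1, …, x_{m}` of a Lyapunov pair in dimension `m+1`, the term `W_{m+1}`
acts as a disturbance. -/
theorem IsLyapunovPair.exists_fderiv_Vpart_le {m : ℕ} {l : ℕ → ℝ} {c : ℝ} (hn : 2 ≤ m + 1)
    (h : IsLyapunovPair (m + 1) l c) : ∃ K c₁ : ℝ, 0 < K ∧ 0 < c₁ ∧ ∀ x : Fin (m + 1) → ℝ,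
      fderiv ℝ (Vpart (m + 1) l m) x ((J (m + 1)).mulVec x) ≤
        -c₁ * V (m + 1) l x ^ α (m + 1) + K * W (m + 1) l (m + 1) x ^ α (m + 1) := by
  have hm : m < m + 1 := Nat.lt_succ_self m
  obtain ⟨_, hc, hx⟩ := (isLyapunovPair_iff hn).1 h
  -- Where W_n = 0, both ω_n and x_n - v_{n-1} vanish, so V_n and V_{n-1} have the same drift
  -- derivative, and the Lyapunov inequality makes it negative.
  have hneg : ∀ x ∈ Set.univ, x ≠ 0 → W (m + 1) l (m + 1) x ^ α (m + 1) = 0 →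
      fderiv ℝ (Vpart (m + 1) l m) x ((J (m + 1)).mulVec x) < 0 := by
    intro x _ hx0 hW
    have hxv := coord_eq_v_of_W_eq_zero hn hm
      (((Real.rpow_eq_zero_iff_of_nonneg (W_nonneg (l := l) hn hm x)).1 hW).1)
    have hω := (ω_eq_zero_iff (l := l) hn hm).2 hxv
    have h1 := hx x
    rw [← Vpart_self, fderiv_Vpart_succ_J hn hm, hω, hxv] at h1
    have h2 : 0 < Vpart (m + 1) l (m + 1) x := by
      refine lt_of_le_of_ne (Vpart_nonneg hn le_rfl x) fun h0 => hx0 (ext_coord fun j hj => ?_)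
      rw [(eq_zero_of_Vpart_eq_zero hn _ le_rfl h0.symm).1 j hj]
      simp [← coordL_apply]
    have h3 := mul_pos hc (Real.rpow_pos_of_pos h2 (α (m + 1)))
    simp only [sub_self, zero_mul, sub_zero, abs_zero, mul_zero, add_zero] at h1
    linarith
  obtain ⟨K, c₁, hK, hc₁, h5⟩ := IsHom.exists_le (two_mul_sub_two_div_pos hn)
    (isHom_fderiv_Vpart_J (l := l) hn hm.le)
    (((isHom_W (l := l) hn hm).rpow (W_nonneg hn hm) (α (m + 1))).congr_deg (mul_α hn))
    (isHom_Vpart_rpow (l := l) hn le_rfl)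
    (continuous_fderiv_J (contDiff_Vpart hn hm.le))
    ((contDiff_W hn hm).continuous.rpow_const fun _ => Or.inr (α_pos hn).le)
    (continuous_Vpart_rpow hn le_rfl)
    (fun x => Real.rpow_nonneg (W_nonneg hn hm x) _)
    (fun x => Real.rpow_nonneg (Vpart_nonneg hn le_rfl x) _)
    isClosed_univ (fun _ _ _ _ => trivial) hneg
  exact ⟨K, c₁, hK, hc₁, fun x => h5 x trivial⟩

/-! ### Absolutely continuous functions -/

theorem absolutelyContinuousOnInterval_comp_of_lipschitzOnWith {X Y : Type*} [PseudoMetricSpace X]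
    [PseudoMetricSpace Y] {f : ℝ → X} {g : X → Y} {a b : ℝ} {K : NNReal}
    (hg : LipschitzOnWith K g (f '' Set.uIcc a b)) (hf : AbsolutelyContinuousOnInterval f a b) :
    AbsolutelyContinuousOnInterval (fun t => g (f t)) a b := by
  rw [absolutelyContinuousOnInterval_iff] at hf ⊢
  intro ε hε
  obtain ⟨δ, hδ, h⟩ := hf (ε / (K + 1)) (by positivity)
  refine ⟨δ, hδ, fun E hE hlt => ?_⟩
  have h1 := h E hE hlt
  rw [lt_div_iff₀ (by positivity)] at h1
  have h2 : ∑ i ∈ Finset.range E.1, dist (g (f (E.2 i).1)) (g (f (E.2 i).2)) ≤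
      ∑ i ∈ Finset.range E.1, K * dist (f (E.2 i).1) (f (E.2 i).2) :=
    Finset.sum_le_sum fun i hi => by
      obtain ⟨h3, h4⟩ := hE.1 i hi
      exact hg.dist_le_mul _ ⟨_, h3, rfl⟩ _ ⟨_, h4, rfl⟩
  rw [← Finset.mul_sum] at h2
  have h5 : 0 ≤ ∑ i ∈ Finset.range E.1, dist (f (E.2 i).1) (f (E.2 i).2) :=
    Finset.sum_nonneg fun _ _ => dist_nonneg
  nlinarith

theorem absolutelyContinuousOnInterval_comp_of_contDiff {E : Type*} [NormedAddCommGroup E]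
    [NormedSpace ℝ E] {f : ℝ → E} {g : E → ℝ} {a b : ℝ} (hg : ContDiff ℝ 1 g)
    (hf : AbsolutelyContinuousOnInterval f a b) :
    AbsolutelyContinuousOnInterval (fun t => g (f t)) a b := by
  have hc : IsCompact (f '' Set.uIcc a b) := isCompact_uIcc.image_of_continuousOn hf.continuousOn
  obtain ⟨K, hK⟩ := (hg.locallyLipschitz.locallyLipschitzOn).exists_lipschitzOnWith_of_compact hc
  exact absolutelyContinuousOnInterval_comp_of_lipschitzOnWith hK hf

theorem sub_le_of_deriv_le {y : ℝ → ℝ} {s t m : ℝ} (hst : s ≤ t)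
    (hy : AbsolutelyContinuousOnInterval y s t)
    (hd : ∀ᵐ r, r ∈ Set.Ioc s t → deriv y r ≤ m) : y t - y s ≤ m * (t - s) := by
  rw [← hy.integral_deriv_eq_sub]
  have h1 : ∫ _ in s..t, m = m * (t - s) := by simp [mul_comm]
  rw [← h1, intervalIntegral.integral_of_le hst, intervalIntegral.integral_of_le hst]
  refine integral_mono_ae ?_ ?_ ((ae_restrict_iff' measurableSet_Ioc).2 hd)
  · exact (intervalIntegrable_iff_integrableOn_Ioc_of_le hst).1 hy.intervalIntegrable_deriv
  · exact (intervalIntegrable_iff_integrableOn_Ioc_of_le hst).1 intervalIntegrable_const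

/-- A comparison principle for `y' ≤ -a y^γ + b`. -/
theorem eventually_rpow_le_of_deriv_le {y : ℝ → ℝ} {a b γ : ℝ} (ha : 0 < a) (hγ : 0 < γ)
    (hy0 : ∀ t, 0 ≤ y t) (hac : ∀ T, 0 ≤ T → AbsolutelyContinuousOnInterval y 0 T)
    (hd : ∀ᵐ t ∂(volume.restrict (Set.Ioi (0 : ℝ))), deriv y t ≤ -a * y t ^ γ + b)
    {ε : ℝ} (hε : 0 < ε) : ∀ᶠ t in atTop, y t ^ γ ≤ b / a + ε := by
  rw [ae_restrict_iff' measurableSet_Ioi] at hd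
  set M := b / a + ε
  have hM : a * M = b + a * ε := by simp only [M]; field_simp
  -- As long as y^γ exceeds M, the function y decreases at rate at least aε.
  have key : ∀ s t, 0 ≤ s → s ≤ t → (∀ r ∈ Set.Ioc s t, M < y r ^ γ) →
      y t - y s ≤ -(a * ε) * (t - s) := by
    intro s t hs hst h
    refine sub_le_of_deriv_le hst ((hac t (hs.trans hst)).mono ?_) ?_
    · rw [Set.uIcc_of_le hst, Set.uIcc_of_le (hs.trans hst)]
      exact Set.Icc_subset_Icc_left hs
    · filter_upwards [hd] with r hr hrm
      have h1 := hr (hs.trans_lt hrm.1)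
      have h2 := mul_lt_mul_of_pos_left (h r hrm) ha
      linarith
  have haε : 0 < a * ε := mul_pos ha hε
  obtain ⟨t₀, ht₀, hyt₀⟩ : ∃ t₀, 0 ≤ t₀ ∧ y t₀ ^ γ ≤ M := by
    by_contra! h
    -- By this time y would have dropped by at least y(0) + 1, contradicting y ≥ 0.
    have hT : 0 ≤ (y 0 + 1) / (a * ε) := div_nonneg (by linarith [hy0 0]) haε.le
    have h1 := key 0 _ le_rfl hT fun r hr => h r hr.1.le
    rw [sub_zero, neg_mul, mul_div_cancel₀ _ haε.ne'] at h1
    linarith [hy0 ((y 0 + 1) / (a * ε))]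
  filter_upwards [eventually_ge_atTop t₀] with t ht
  by_contra! hlt
  have hcont : ContinuousOn (fun r => y r ^ γ) (Set.Icc t₀ t) := by
    have := (hac t (ht₀.trans ht)).continuousOn
    rw [Set.uIcc_of_le (ht₀.trans ht)] at this
    exact (this.mono (Set.Icc_subset_Icc_left ht₀)).rpow_const fun _ _ => Or.inr hγ.le
  have hcl : IsCompact (Set.Icc t₀ t ∩ (fun r => y r ^ γ) ⁻¹' Set.Iic M) :=
    isCompact_Icc.of_isClosed_subset (hcont.preimage_isClosed_of_isClosed isClosed_Icc isClosed_Iic)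
      Set.inter_subset_left
  -- Here s is the last time before t at which y^γ ≤ M; from s to t the function y decreases, so y^γ
  -- cannot exceed M at t.
  obtain ⟨s, ⟨hs, hsM⟩, hmax⟩ := hcl.exists_isGreatest ⟨t₀, ⟨le_rfl, ht⟩, hyt₀⟩
  have h1 := key s t (ht₀.trans hs.1) hs.2 fun r hr => by
    by_contra! hle
    exact absurd (hmax ⟨⟨hs.1.trans hr.1.le, hr.2⟩, hle⟩) (not_le.2 hr.1)
  have h2 : y t ≤ y s := by nlinarith [hs.2]
  have h3 := Real.rpow_le_rpow (hy0 t) h2 hγ.le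
  have h4 : y s ^ γ ≤ M := hsM
  linarith

theorem limsup_coe_le {f : ℝ → ℝ} {R : ℝ} (h : ∀ ε > 0, ∀ᶠ t in atTop, f t ≤ R + ε) :
    limsup (fun t => ((f t : ℝ) : EReal)) atTop ≤ (R : EReal) := by
  refine le_of_forall_gt_imp_ge_of_dense fun z hz => ?_
  obtain ⟨q, hq1, hq2⟩ := EReal.lt_iff_exists_real_btwn.1 hz
  rw [EReal.coe_lt_coe_iff] at hq1
  refine (limsup_le_of_le (h := ?_)).trans hq2.le
  filter_upwards [h (q - R) (by linarith)] with t ht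
  rw [EReal.coe_le_coe_iff]
  linarith

/-! ### S-functions -/

theorem mul_sat_nonneg {b : ℝ} (hb : 0 < b) (x : ℝ) : 0 ≤ x * sat (x / b) := by
  have : x * sat (x / b) = x ^ 2 / (b * max 1 |x / b|) := by
    rw [sat]
    field_simp
  rw [this]
  positivity

section sfunction

variable {σ : ℝ → ℝ} {L C : ℝ}

theorem IsSFunction.mul_nonneg (h : IsSFunction σ L C) (x : ℝ) : 0 ≤ x * σ x := by
  obtain ⟨a₁, a₂, b₁, b₂, ha₁, hb₁, -, -, -, hx⟩ := h.sector
  refine le_trans ?_ (hx x).1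
  rw [mul_assoc]
  exact _root_.mul_nonneg ha₁.le (mul_sat_nonneg hb₁ x)

/-- Away from the disturbance, `σ_k` acts almost like the sign. -/
theorem IsSFunction.abs_sub_mul_le (h : IsSFunction σ L C) (hL : 1 ≤ L) {k D w d : ℝ} (hk : 0 < k)
    (hd : |d| ≤ D) (hw : 2 * D ≤ |w|) : |w| - w * σ (k * (w + d)) ≤ 2 * C / k := by
  have hC := h.rate_pos
  -- Since |d| ≤ |w|/2, the sum w + d has the sign of w and at least half its size. The rate C/(1 +
  -- k|w + d|) times |w| is then at most 2C/k.
  have hbound : ∀ y w : ℝ, 0 < w → w / 2 ≤ y → w * (C / (1 + k * y)) ≤ 2 * C / k := by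
    intro y w hw hy
    have h1 : 0 ≤ k * y := by have : 0 ≤ y := by linarith
                              positivity
    rw [mul_div_assoc', div_le_div_iff₀ (by linarith) hk]
    have : k * (w / 2) ≤ k * y := by gcongr
    nlinarith
  rw [abs_le] at hd
  rcases lt_trichotomy w 0 with h0 | rfl | h0
  · rw [abs_of_neg h0] at hw ⊢
    have hy : -w / 2 ≤ -(w + d) := by linarith
    have h1 := (abs_le.1 (h.rate_left (k * -(w + d)))).2
    rw [abs_of_nonneg (_root_.mul_nonneg hk.le (by linarith)), mul_neg, neg_neg, ← mul_neg] at h1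
    have h2 := hbound (-(w + d)) (-w) (by linarith) hy
    nlinarith
  · rw [abs_zero, zero_mul, sub_zero]; positivity
  · rw [abs_of_pos h0] at hw ⊢
    have hy : w / 2 ≤ w + d := by linarith
    have h1 := (abs_le.1 (h.rate_right (k * (w + d)))).1
    rw [abs_of_nonneg (_root_.mul_nonneg hk.le (by linarith))] at h1
    have h2 := hbound (w + d) w h0 hy
    nlinarith

/-- For |w| < 2D there are two cases. If w and w + d have the same strict sign, then w σ ≥ 0 and the
left side is at most 2D. Otherwise |w| ≤ |d| ≤ D, and |σ| ≤ 3 gives at most (1 + 3)D. -/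
theorem IsSFunction.abs_sub_mul_le_of_le_three (h : IsSFunction σ L C) (hL : 1 ≤ L)
    (hσ : ∀ y, |σ y| ≤ 3) {k D w d : ℝ} (hk : 0 < k) (hd : |d| ≤ D) :
    |w| - w * σ (k * (w + d)) ≤ 2 * C / k + 4 * D := by
  have hC := h.rate_pos
  have hD : 0 ≤ D := (abs_nonneg d).trans hd
  have hCk : 0 ≤ 2 * C / k := by positivity
  rcases le_or_gt (2 * D) |w| with hw | hw
  · linarith [h.abs_sub_mul_le hL hk hd hw]
  · by_cases hs : 0 < w * (w + d)
    · have h1 := h.mul_nonneg (k * (w + d))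
      have h2 : 0 ≤ w * σ (k * (w + d)) := by
        have h3 : w + d ≠ 0 := right_ne_zero_of_mul hs.ne'
        have h4 : 0 < (w + d) ^ 2 * k := by positivity
        have h5 : 0 ≤ ((w + d) ^ 2 * k) * (w * σ (k * (w + d))) := by
          have := _root_.mul_nonneg hs.le h1
          linarith
        exact nonneg_of_mul_nonneg_right h5 h4
      linarith
    · have h1 : |w| ≤ D := by
        have : w ^ 2 ≤ d ^ 2 := by nlinarith [sq_nonneg (w + d)]
        exact (sq_le_sq.1 this).trans hd
      have h2 : -(w * σ (k * (w + d))) ≤ |w| * 3 := by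
        refine (neg_le_abs _).trans ?_
        rw [abs_mul]
        exact mul_le_mul_of_nonneg_left (hσ _) (abs_nonneg w)
      linarith

end sfunction

/-! ### Trajectories -/

theorem ae_abs_le_normLinfty {d : ℝ → ℝ} (hd : MemLinfty d) :
    ∀ᵐ t ∂(volume.restrict (Set.Ioi (0 : ℝ))), |d t| ≤ normLinfty d := by
  have h1 : ∀ᵐ t ∂(volume.restrict (Set.Ici (0 : ℝ))), |d t| ≤ normLinfty d := by
    have h2 := hd.2
    rw [eLpNorm_exponent_top] at h2
    filter_upwards [ae_le_eLpNormEssSup (f := d) (μ := volume.restrict (Set.Ici (0 : ℝ)))] with t ht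
    rw [normLinfty, eLpNorm_exponent_top, ← Real.norm_eq_abs, ← toReal_enorm]
    exact ENNReal.toReal_mono h2.ne ht
  exact ae_mono (Measure.restrict_mono Set.Ioi_subset_Ici_self le_rfl) h1

section trajectory

variable {n : ℕ} {l : ℕ → ℝ} {c : ℝ} {σ : ℝ → ℝ} {L C : ℝ} {k : ℝ} {d : ℝ → ℝ} {x : ℝ → Fin n → ℝ}

/-- The derivative of `V_n` along a trajectory at a point where the equation holds. -/
theorem IsLyapunovPair.deriv_V_le (hn : 2 ≤ n) (h : IsLyapunovPair n l c) {t : ℝ}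
    (hx : HasDerivAt x ((J n).mulVec (x t) - (l n * σ (k * (ω n l n (x t) + d t))) • eLast n) t) :
    deriv (fun t => V n l (x t)) t ≤ -c * V n l (x t) ^ α n +
      l n * (|ω n l n (x t)| - ω n l n (x t) * σ (k * (ω n l n (x t) + d t))) := by
  have h1 := (hasFDerivAt_V l hn (x t)).comp_hasDerivAt t hx
  have h2 := ((isLyapunovPair_iff hn).1 h).2.2 (x t)
  rw [map_sub, map_smul, fderiv_V_eLast hn, smul_eq_mul] at h1
  rw [show deriv (fun t => V n l (x t)) t = _ from h1.deriv]
  linarith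

theorem practicalBound_of_abs_le_three (hn : 2 ≤ n) (h : IsLyapunovPair n l c)
    (hσ : IsSFunction σ L C) (hL : 1 ≤ L) (h3 : ∀ y, |σ y| ≤ 3) : PracticalBound n l c σ C := by
  refine ⟨1, one_pos, fun k hk d hd x hx => limsup_coe_le fun ε hε => ?_⟩
  have hk0 : 0 < k := one_pos.trans_le hk
  have hl : 0 < l n := h.1 n (by omega) le_rfl
  have hc : 0 < c := h.2.1
  have hD : 0 ≤ normLinfty d := ENNReal.toReal_nonneg
  have hcomp := eventually_rpow_le_of_deriv_le (y := fun t => V n l (x t))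
    (b := l n * (2 * C / k + 4 * normLinfty d)) hc (α_pos hn) (fun t => V_nonneg l hn (x t))
    (fun T hT => absolutelyContinuousOnInterval_comp_of_contDiff
      (contDiff_Vpart (l := l) hn le_rfl) (hx.1 T hT))
    (by
      filter_upwards [hx.2, ae_abs_le_normLinfty hd] with t ht htd
      refine (h.deriv_V_le hn ht).trans ?_
      gcongr
      exact hσ.abs_sub_mul_le_of_le_three hL h3 hk0 htd) hε
  filter_upwards [hcomp] with t ht
  refine ht.trans ?_
  gcongr
  rw [div_le_iff₀ hc]
  have h5 : 2 * C / k ≤ 2 * ((1 + C) / k) := by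
    rw [mul_div_assoc]
    gcongr
    linarith
  have h6 : 2 * l n / c * ((1 + C) / k + 2 * normLinfty d) * c =
      l n * (2 * ((1 + C) / k) + 4 * normLinfty d) := by
    field_simp
    ring
  rw [h6]
  gcongr

end trajectory

/-! ### The modified Lyapunov function and unrestricted S-functions -/

section modified

variable {m : ℕ} {l : ℕ → ℝ}

/-- The function `V_n` with its last term `W_n` replaced by `max W_n τ`. -/
def truncV (m : ℕ) (l : ℕ → ℝ) (τ : ℝ) (x : Fin (m + 1) → ℝ) : ℝ :=
  Vpart (m + 1) l m x + max (W (m + 1) l (m + 1) x) τ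

theorem V_le_truncV (l : ℕ → ℝ) (τ : ℝ) (x : Fin (m + 1) → ℝ) : V (m + 1) l x ≤ truncV m l τ x := by
  rw [← Vpart_self, Vpart_succ, truncV]
  gcongr
  exact le_max_left _ _

/-- With τ = 2E^(1 + 1/β), this makes τ^α at most 2E, so the truncation costs an amount linear in E.
-/
theorem one_add_inv_β_mul_α (hn : 2 ≤ m + 1) : (1 + (β (m + 1) m)⁻¹) * α (m + 1) = 1 := by
  have h2 : (1 : ℝ) ≤ m := by exact_mod_cast (by omega : 1 ≤ m)
  have h3 : (m : ℝ) ≠ 0 := by linarith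
  have h4 : 2 * (m : ℝ) + 1 ≠ 0 := by linarith
  rw [β_eq (by omega), α]
  push_cast
  rw [show (m : ℝ) + 1 - 1 + m = 2 * m by ring, show (m : ℝ) + 1 - m = 1 by ring,
    show 2 * ((m : ℝ) + 1) - 1 = 2 * m + 1 by ring, show (m : ℝ) + 1 - 1 = m by ring]
  field_simp

theorem absolutelyContinuousOnInterval_max {f : ℝ → ℝ} {a b : ℝ} (τ : ℝ)
    (hf : AbsolutelyContinuousOnInterval f a b) :
    AbsolutelyContinuousOnInterval (fun t => max (f t) τ) a b :=
  absolutelyContinuousOnInterval_comp_of_lipschitzOnWith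
    ((LipschitzWith.id.max_const τ).lipschitzOnWith (s := f '' Set.uIcc a b)) hf

theorem ae_differentiableAt_of_absolutelyContinuous {f : ℝ → ℝ}
    (hf : ∀ T, 0 ≤ T → AbsolutelyContinuousOnInterval f 0 T) :
    ∀ᵐ t ∂(volume.restrict (Set.Ioi (0 : ℝ))), DifferentiableAt ℝ f t := by
  rw [ae_restrict_iff' measurableSet_Ioi]
  have h : ∀ N : ℕ, ∀ᵐ t, t ∈ Set.uIcc (0 : ℝ) N → DifferentiableAt ℝ f t :=
    fun N => (hf N N.cast_nonneg).ae_differentiableAt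
  filter_upwards [ae_all_iff.2 h] with t ht ht0
  obtain ⟨N, hN⟩ := exists_nat_ge t
  exact ht N (by rw [Set.uIcc_of_le N.cast_nonneg]; exact ⟨le_of_lt ht0, hN⟩)

/-- The derivative of the modified Lyapunov function along a trajectory. -/
theorem deriv_truncV_le {c c₁ K L C k D : ℝ} {σ d : ℝ → ℝ} {x : ℝ → Fin (m + 1) → ℝ}
    (hn : 2 ≤ m + 1) (h : IsLyapunovPair (m + 1) l c) (hK : 0 < K) (hc₁ : 0 < c₁)
    (hsub : ∀ x : Fin (m + 1) → ℝ,
      fderiv ℝ (Vpart (m + 1) l m) x ((J (m + 1)).mulVec x) ≤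
        -c₁ * V (m + 1) l x ^ α (m + 1) + K * W (m + 1) l (m + 1) x ^ α (m + 1))
    (hσ : IsSFunction σ L C) (hL : 1 ≤ L) (hk : 0 < k) {t : ℝ} (hd : |d t| ≤ D)
    (hx : HasDerivAt x ((J (m + 1)).mulVec (x t) -
      (l (m + 1) * σ (k * (ω (m + 1) l (m + 1) (x t) + d t))) • eLast (m + 1)) t)
    {E τ : ℝ} (hE : 2 * D ≤ E) (hE0 : 0 ≤ E) (hτ : τ = 2 * E ^ (1 + (β (m + 1) m)⁻¹))
    (hdiff : DifferentiableAt ℝ (fun t => max (W (m + 1) l (m + 1) (x t)) τ) t) :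
    deriv (fun t => truncV m l τ (x t)) t ≤ -min c c₁ * truncV m l τ (x t) ^ α (m + 1) +
      (l (m + 1) * (2 * C / k) + (c₁ + K) * (2 * E)) := by
  have hm : m < m + 1 := Nat.lt_succ_self m
  have hC := hσ.rate_pos
  have hl : 0 < l (m + 1) := h.1 (m + 1) (by omega) le_rfl
  have hα := α_pos hn
  have hV0 := V_nonneg l hn (x t)
  have hW0 := W_nonneg (l := l) hn hm (x t)
  have hτ0 : 0 ≤ τ := by rw [hτ]; positivity
  have hP := ((contDiff_Vpart (l := l) hn hm.le).differentiable one_ne_zero (x t)).hasFDerivAt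
  have hPd := hP.comp_hasDerivAt t hx
  rw [map_sub, map_smul, fderiv_eLast hm ((contDiff_Vpart hn hm.le).differentiable one_ne_zero)
    (Vpart_trunc le_rfl), smul_zero, sub_zero] at hPd
  rcases lt_or_ge τ (W (m + 1) l (m + 1) (x t)) with hcase | hcase
  · have hWc : ContinuousAt (fun t => W (m + 1) l (m + 1) (x t)) t :=
      (contDiff_W (l := l) hn hm).continuous.continuousAt.comp hx.continuousAt
    have heq : (fun t => truncV m l τ (x t)) =ᶠ[𝓝 t] fun t => V (m + 1) l (x t) := by
      filter_upwards [hWc.eventually_const_lt hcase] with s hs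
      rw [truncV, max_eq_left hs.le, ← Vpart_self, Vpart_succ]
    rw [heq.deriv_eq, heq.eq_of_nhds]
    -- By `W_le`, |ω_n| < E would force W_n ≤ τ.
    have hω : E ≤ |ω (m + 1) l (m + 1) (x t)| := by
      by_contra! hlt
      have h1 := W_le (l := l) hn (by omega : 1 ≤ m) hm (x t)
      have h2 : |ω (m + 1) l (m + 1) (x t)| ^ (1 + (β (m + 1) m)⁻¹) ≤
          E ^ (1 + (β (m + 1) m)⁻¹) :=
        Real.rpow_le_rpow (abs_nonneg _) hlt.le
          (by have := β_pos hn hm; positivity)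
      linarith
    have h1 := h.deriv_V_le hn hx
    have h2 := mul_le_mul_of_nonneg_left
      (hσ.abs_sub_mul_le hL hk hd (hE.trans hω)) hl.le
    have h3 : min c c₁ * V (m + 1) l (x t) ^ α (m + 1) ≤ c * V (m + 1) l (x t) ^ α (m + 1) :=
      mul_le_mul_of_nonneg_right (min_le_left _ _) (Real.rpow_nonneg hV0 _)
    have h4 : 0 ≤ (c₁ + K) * (2 * E) := by positivity
    linarith
  -- The maximum takes its least value τ here, so its derivative, which exists by assumption, is 0.
  -- This includes the points where W_n = τ.
  · have hmin : IsLocalMin (fun t => max (W (m + 1) l (m + 1) (x t)) τ) t :=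
      Filter.Eventually.of_forall fun s => by
        simp only [max_eq_right hcase]
        exact le_max_right _ _
    have hM := hdiff.hasDerivAt
    rw [hmin.deriv_eq_zero] at hM
    have hU := hPd.add hM
    rw [add_zero] at hU
    rw [show deriv (fun t => truncV m l τ (x t)) t = _ from hU.deriv]
    have hτα : τ ^ α (m + 1) ≤ 2 * E := by
      rw [hτ, Real.mul_rpow two_pos.le (by positivity), ← Real.rpow_mul hE0,
        one_add_inv_β_mul_α hn, Real.rpow_one]
      gcongr
      simpa using Real.rpow_le_rpow_of_exponent_le one_le_two (α_le_one hn)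
    have hUV : truncV m l τ (x t) ^ α (m + 1) ≤ V (m + 1) l (x t) ^ α (m + 1) + τ ^ α (m + 1) := by
      refine le_trans (Real.rpow_le_rpow ?_ ?_ hα.le)
        (Real.rpow_add_le_add_rpow hV0 hτ0 hα.le (α_le_one hn))
      · exact hV0.trans (V_le_truncV l τ (x t))
      · rw [truncV, max_eq_right hcase, ← Vpart_self, Vpart_succ]
        linarith
    have hWτ : W (m + 1) l (m + 1) (x t) ^ α (m + 1) ≤ τ ^ α (m + 1) :=
      Real.rpow_le_rpow hW0 hcase hα.le
    have hU0 : 0 ≤ truncV m l τ (x t) ^ α (m + 1) :=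
      Real.rpow_nonneg (hV0.trans (V_le_truncV l τ (x t))) _
    have h1 := hsub (x t)
    have h2 := mul_le_mul_of_nonneg_left hUV hc₁.le
    have h3 := mul_le_mul_of_nonneg_left hWτ hK.le
    have h4 := mul_le_mul_of_nonneg_right (min_le_right c c₁) hU0
    have h5 := mul_le_mul_of_nonneg_left hτα (add_pos hc₁ hK).le
    have h6 : 0 ≤ l (m + 1) * (2 * C / k) := by positivity
    linarith

theorem IsLyapunovPair.exists_practicalBound (hn : 2 ≤ m + 1) {c : ℝ}
    (h : IsLyapunovPair (m + 1) l c) :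
    ∃ c' : ℝ, 0 < c' ∧ c' ≤ c ∧ ∀ (σ : ℝ → ℝ) (L C : ℝ), IsSFunction σ L C → 1 ≤ L →
      PracticalBound (m + 1) l c' σ C := by
  have hm : m < m + 1 := Nat.lt_succ_self m
  obtain ⟨K, c₁, hK, hc₁, hsub⟩ := h.exists_fderiv_Vpart_le hn
  have hl : 0 < l (m + 1) := h.1 (m + 1) (by omega) le_rfl
  have hc : 0 < c := h.2.1
  have ha : 0 < min c c₁ := lt_min hc hc₁
  set a := min c c₁
  set M := 2 * l (m + 1) + 2 * (c₁ + K)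
  have hM : 0 < M := by positivity
  -- The comparison principle yields the bound (M/a)((1 + C)/k + 2D); the second entry of the
  -- minimum ensures M/a ≤ 2 l_n / c'. Neither a nor M depends on σ.
  refine ⟨min c (2 * l (m + 1) * a / M), lt_min hc (by positivity), min_le_left _ _,
    fun σ L C hσ hL => ⟨1, one_pos, fun k hk d hd x hx => limsup_coe_le fun ε hε => ?_⟩⟩
  have hk0 : 0 < k := one_pos.trans_le hk
  have hC := hσ.rate_pos
  have hD : 0 ≤ normLinfty d := ENNReal.toReal_nonneg
  set D := normLinfty d
  -- The threshold E = 2D + 1/k satisfies E ≥ 2D, and its contribution is absorbed by (1 + C)/k + 2D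
  -- in the final bound.
  set τ := 2 * (2 * D + 1 / k) ^ (1 + (β (m + 1) m)⁻¹) with hτ
  have hmaxAC : ∀ T, 0 ≤ T →
      AbsolutelyContinuousOnInterval (fun t => max (W (m + 1) l (m + 1) (x t)) τ) 0 T :=
    fun T hT => absolutelyContinuousOnInterval_max τ
      (absolutelyContinuousOnInterval_comp_of_contDiff (contDiff_W hn hm) (hx.1 T hT))
  have hcomp := eventually_rpow_le_of_deriv_le (y := fun t => truncV m l τ (x t)) ha (α_pos hn)
    (fun t => (V_nonneg l hn (x t)).trans (V_le_truncV l τ (x t)))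
    (fun T hT => (absolutelyContinuousOnInterval_comp_of_contDiff
      (contDiff_Vpart (l := l) hn hm.le) (hx.1 T hT)).add (hmaxAC T hT))
    (by
      filter_upwards [hx.2, ae_abs_le_normLinfty hd,
        ae_differentiableAt_of_absolutelyContinuous hmaxAC] with t ht htd htm
      exact deriv_truncV_le hn h hK hc₁ hsub hσ hL hk0 htd ht
        (by have : 0 < 1 / k := by positivity
            linarith) (by positivity) hτ htm) hε
  filter_upwards [hcomp] with t ht
  have h1 := Real.rpow_le_rpow (V_nonneg l hn (x t)) (V_le_truncV l τ (x t)) (α_pos hn).le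
  refine h1.trans (ht.trans ?_)
  gcongr
  have h2 : l (m + 1) * (2 * C / k) + (c₁ + K) * (2 * (2 * D + 1 / k)) ≤
      M * ((1 + C) / k + 2 * D) := by
    have h3 : M * ((1 + C) / k + 2 * D) =
        l (m + 1) * (2 * C / k) + (c₁ + K) * (2 * (2 * D + 1 / k)) +
        (2 * l (m + 1) * (1 / k) + 2 * (c₁ + K) * (C / k) + 4 * l (m + 1) * D) := by
      simp only [M]
      ring
    rw [h3]
    have : 0 ≤ 2 * l (m + 1) * (1 / k) + 2 * (c₁ + K) * (C / k) + 4 * l (m + 1) * D := by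
      positivity
    linarith
  have hX : 0 ≤ (1 + C) / k + 2 * D := by positivity
  have h4 : M / a ≤ 2 * l (m + 1) / min c (2 * l (m + 1) * a / M) := by
    have h5 : M / a = 2 * l (m + 1) / (2 * l (m + 1) * a / M) := by
      field_simp
    rw [h5]
    exact div_le_div_of_nonneg_left (by positivity) (lt_min hc (by positivity)) (min_le_right _ _)
  calc (l (m + 1) * (2 * C / k) + (c₁ + K) * (2 * (2 * D + 1 / k))) / a
      ≤ M * ((1 + C) / k + 2 * D) / a := by gcongr
    _ = M / a * ((1 + C) / k + 2 * D) := by ring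
    _ ≤ _ := mul_le_mul_of_nonneg_right h4 hX

end modified

end HongFeedback

end

theorem proposition1 (n : ℕ) (hn : 2 ≤ n) :
    (∃ (l : ℕ → ℝ) (c : ℝ), HongFeedback.IsLyapunovPair n l c) ∧
    ∀ (l : ℕ → ℝ) (c : ℝ), HongFeedback.IsLyapunovPair n l c →
      (∀ (σ : ℝ → ℝ) (L C : ℝ), HongFeedback.IsSFunction σ L C → 1 ≤ L → (∀ y, |σ y| ≤ 3) →
        HongFeedback.PracticalBound n l c σ C) ∧
      ∃ c' : ℝ, 0 < c' ∧ c' ≤ c ∧ HongFeedback.IsLyapunovPair n l c' ∧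
        ∀ (σ : ℝ → ℝ) (L C : ℝ), HongFeedback.IsSFunction σ L C → 1 ≤ L →
          HongFeedback.PracticalBound n l c' σ C := by
  refine ⟨HongFeedback.exists_isLyapunovPair hn, fun l c h => ⟨fun σ L C hσ hL h3 =>
    HongFeedback.practicalBound_of_abs_le_three hn h hσ hL h3, ?_⟩⟩
  obtain ⟨m, rfl⟩ : ∃ m, n = m + 1 := ⟨n - 1, by omega⟩
  obtain ⟨c', hc0, hcc, hB⟩ := h.exists_practicalBound hn
  exact ⟨c', hc0, hcc, h.mono hn hc0 hcc, hB⟩
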